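/- **Setting.** Let $g:[0,1]\to[0,1]$ be an absolutely continuous distortion function, i.e. non-decreasing with $g(0)=0$, $g(1)=1$. Let $\gamma(u)=\partial_-g(x)|_{x=1-u}$ ($0<u<1$) be its weight function, where $\partial_-$ is the left derivative. Assume that $\int_0^1\gamma(u)^2\,du<\infty$ and that $\gamma$ is not equal to $1$ almost everywhere. For a distribution function $G$ with finite second moment, let $$H_g(G)=-\int_{-\infty}^0\bigl(1-g(1-G(x))\bigr)dx+\int_0^\infty g(1-G(x))\,dx ,$$ and let $G^{-1}(u)=\inf\{y: G(y)\ge u\}$ be its quantile function. Let $F$ be a reference distribution with mean $\mu_F$ and variance $\sigma_F^2\in(0,\infty)$, let $\mu\in\mathbb R$, $\sigma>0$, and for $0\le\varepsilon\le+\infty$ let $\mathcal M_\varepsilon(\mu,\sigma)$ be the set of distribution functions $G$ with mean $\mu$, second moment $\mu^2+\sigma^2$ and $d_W(F,G)\le\sqrt\varepsilon$, where $d_W$ is the Wasserstein distance of order $2$ (the infimum of $(\mathbb E(X_1-X_2)^2)^{1/2}$ over all couplings). Let $U$ be uniform on $(0,1)$. For $\lambda\ge0$ let $k_\lambda^\downarrow$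 be the minimiser of $\|\gamma-\lambda F^{-1}-k\|_{L^2(0,1)}$ over all square-integrable, non-increasing, left-continuous $k:(0,1)\to\mathbb R$; write $\gamma^\downarrow=k_0^\downarrow$, and $\lambda^\downarrow=\inf\{\lambda\ge0: k^\downarrow_\lambda\text{ is not constant}\}$ (with $\inf\emptyset=+\infty$). Whenever $k_\lambda^\downarrow$ is not constant, put $$h_\lambda^\downarrow(u)=\mu+\sigma\,\frac{a_\lambda-k_\lambda^\downarrow(u)}{b_\lambda},\qquad a_\lambda=\mathbb E\bigl(k^\downarrow_\lambda(U)\bigr),\quad b_\lambda=\mathrm{std}\bigl(k_\lambda^\downarrow(U)\bigr).$$ **Theorem.** Assume $\lambda^\downarrow=0$. Then the minimisers $k_\lambda^\downarrow$ ($\lambda\ge 0$) exist and are unique, the limit $c_0=\lim_{\lambda\searrow0}\mathrm{corr}\bigl(F^{-1}(U),-k_\lambda^\downarrow(U)\bigr)$ exists, and, with $\underline\varepsilon=(\mu_F-\mu)^2+(\sigma_F-\sigma)^2$ and $\varepsilon^*=\underline\varepsilon+2\sigma\sigma_F(1-c_0)$, the following hold. 1. If $\underline\varepsilon<\varepsilon<\varepsilon^*$,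 then there is exactly one $\lambda>0$ such that the Wasserstein distance between $F$ and the distribution with quantile function $h_\lambda^\downarrow$ equals $\sqrt\varepsilon$. For this $\lambda$, the problem of minimising $H_g$ over $\mathcal M_\varepsilon(\mu,\sigma)$ has a unique solution, namely the distribution with quantile function $h_\lambda^\downarrow$, and $$\inf_{G\in\mathcal M_\varepsilon(\mu,\sigma)}H_g(G)=H_g(h^\downarrow_\lambda)=\mu-\sigma\,\mathrm{std}(\gamma(U))\,\mathrm{corr}\bigl(\gamma(U),k_\lambda^\downarrow(U)\bigr).$$ This value is continuous in $\varepsilon\in(\underline\varepsilon,\varepsilon^*)$. 2. Let $\varepsilon>\underline\varepsilon$ and $\varepsilon\ge\varepsilon^*$ (possibly $\varepsilon=+\infty$). If $\gamma^\downarrow$ is not constant, then the distribution with quantile function $h_0^\downarrow$ is the unique minimiser of $H_g$ over $\mathcal M_\varepsilon(\mu,\sigma)$, and the infimum is $\mu-\sigma\,\mathrm{std}(\gamma(U))\,\mathrm{corr}(\gamma(U),\gamma^\downarrow(U))$. If $\gamma^\downarrow$ is constant, then the infimum equals $\mu$, and in general it is not attained: it fails to be attained if and only if $g(x)\ne x$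 for every $x\in(0,1)$ (in particular it is not attained when $g$ is concave). -/

import Mathlib

open MeasureTheory Set Filter
open scoped ENNReal Topology

namespace DistortionBounds

/-- The uniform distribution on `(0,1)`, i.e. the law of `U`. -/
noncomputable def unif : Measure ℝ := volume.restrict (Ioo (0 : ℝ) 1)

/-- The mean `E(X(U))`. -/
noncomputable def mean (X : ℝ → ℝ) : ℝ := ∫ u, X u ∂unif

/-- The standard deviation `std(X(U))`. -/
noncomputable def std (X : ℝ → ℝ) : ℝ := Real.sqrt (ProbabilityTheory.variance X unif)

/-- The correlation `corr(X(U), Y(U))`. -/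
noncomputable def corr (X Y : ℝ → ℝ) : ℝ :=
  ProbabilityTheory.covariance X Y unif / (std X * std Y)

/-- The (left-continuous) quantile function `G⁻¹(u) = inf {y | u ≤ G(y)}` of the distribution
function of a law `G` on the real line. -/
noncomputable def quantile (G : Measure ℝ) (u : ℝ) : ℝ :=
  sInf {y : ℝ | u ≤ ProbabilityTheory.cdf G y}

/-- The distribution with quantile function `h`, as the law of `h(U)`. -/
noncomputable def lawOf (h : ℝ → ℝ) : Measure ℝ := unif.map h

/-- The Wasserstein distance of order 2: the infimum of `(E (X₁ - X₂)²)^(1/2)` over all couplings of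
the two laws. -/
noncomputable def wasserstein (G₁ G₂ : Measure ℝ) : ℝ≥0∞ :=
  ⨅ π ∈ {π : Measure (ℝ × ℝ) | π.map Prod.fst = G₁ ∧ π.map Prod.snd = G₂},
    (∫⁻ p, ENNReal.ofReal ((p.1 - p.2) ^ 2) ∂π) ^ (1 / 2 : ℝ)

/-- Distortion functions `g : [0,1] → [0,1]` (values of `g` off `[0,1]` are irrelevant). -/
structure IsDistortion (g : ℝ → ℝ) : Prop where
  monotoneOn : MonotoneOn g (Icc 0 1)
  map_zero : g 0 = 0
  map_one : g 1 = 1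

/-- The distortion risk measure `H_g`, as a Choquet integral. -/
noncomputable def riskMeasure (g : ℝ → ℝ) (G : Measure ℝ) : ℝ :=
  -(∫ x in Iio (0 : ℝ), (1 - g (1 - ProbabilityTheory.cdf G x)))
    + ∫ x in Ioi (0 : ℝ), g (1 - ProbabilityTheory.cdf G x)

/-- The weight function `γ(u)`: the left derivative of `g` at `1 - u`. -/
noncomputable def weight (g : ℝ → ℝ) (u : ℝ) : ℝ := derivWithin g (Iio (1 - u)) (1 - u)

/-- Laws with finite second moment, mean `m` and second moment `m² + s²`. -/
structure HasMoments (G : Measure ℝ) (m s : ℝ) : Prop where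
  isProbabilityMeasure : IsProbabilityMeasure G
  memLp : MemLp (fun x : ℝ => x) 2 G
  first : ∫ x, x ∂G = m
  second : ∫ x, x ^ 2 ∂G = m ^ 2 + s ^ 2

/-- The uncertainty set `M_ε(m, s)` around the reference law `F`; here `ε = ∞` is allowed. -/
def uncertaintySet (F : Measure ℝ) (m s : ℝ) (ε : ℝ≥0∞) : Set (Measure ℝ) :=
  {G | HasMoments G m s ∧ wasserstein F G ≤ ε ^ (1 / 2 : ℝ)}

/-- The best-case value: the infimum of `H_g` over the uncertainty set. -/
noncomputable def bestCaseValue (g : ℝ → ℝ) (F : Measure ℝ) (m s : ℝ) (ε : ℝ≥0∞) : EReal :=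
  ⨅ G ∈ uncertaintySet F m s ε, (riskMeasure g G : EReal)

/-- The best-case distributions: the minimisers of `H_g` over the uncertainty set. -/
def bestCaseSet (g : ℝ → ℝ) (F : Measure ℝ) (m s : ℝ) (ε : ℝ≥0∞) : Set (Measure ℝ) :=
  {G | G ∈ uncertaintySet F m s ε ∧
    ∀ G' ∈ uncertaintySet F m s ε, riskMeasure g G ≤ riskMeasure g G'}

/-- Square-integrable, non-increasing and left-continuous functions on `(0,1)`. -/
structure IsAntitonic (k : ℝ → ℝ) : Prop where
  memLp : MemLp k 2 unif
  antitoneOn : AntitoneOn k (Ioo 0 1)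
  leftCont : ∀ u ∈ Ioo (0 : ℝ) 1, ContinuousWithinAt k (Iic u) u

/-- `k` minimises the `L²(0,1)` distance to `f` among the functions of the previous definition. -/
structure IsAntitonicProj (f k : ℝ → ℝ) : Prop where
  isAntitonic : IsAntitonic k
  le : ∀ k' : ℝ → ℝ, IsAntitonic k' →
    ∫ u, (f u - k u) ^ 2 ∂unif ≤ ∫ u, (f u - k' u) ^ 2 ∂unif

/-- The function `γ - l F⁻¹`. -/
noncomputable def target (g : ℝ → ℝ) (F : Measure ℝ) (l : ℝ) (u : ℝ) : ℝ :=
  weight g u - l * quantile F u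

/-- The antitonic projection `k_l^↓` of `γ - l F⁻¹`. -/
noncomputable def kDown (g : ℝ → ℝ) (F : Measure ℝ) (l : ℝ) : ℝ → ℝ :=
  Classical.epsilon (IsAntitonicProj (target g F l))

/-- `k` is constant on `(0,1)`. -/
def IsConst (k : ℝ → ℝ) : Prop := ∃ c : ℝ, ∀ u ∈ Ioo (0 : ℝ) 1, k u = c

/-- `λ^↓ = inf {l ≥ 0 | k_l^↓ is not constant}`, equal to `+∞` if there is no such `l`. -/
noncomputable def lamDown (g : ℝ → ℝ) (F : Measure ℝ) : EReal :=
  ⨅ l ∈ {l : ℝ | 0 ≤ l ∧ ¬ IsConst (kDown g F l)}, (l : EReal)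

/-- The quantile function `h_l^↓ = m + s (a_l - k_l^↓) / b_l`, where `a_l` and `b_l` are the mean
and the standard deviation of `k_l^↓(U)`. -/
noncomputable def hDown (g : ℝ → ℝ) (F : Measure ℝ) (m s l : ℝ) (u : ℝ) : ℝ :=
  m + s * ((mean (kDown g F l) - kDown g F l u) / std (kDown g F l))

/-- `h_l^↓` is the quantile function of the unique best-case distribution, and the best-case value
is `H_g(h_l^↓) = m - s std(γ(U)) corr(γ(U), k_l^↓(U))`. -/
structure SolvedBy (g : ℝ → ℝ) (F : Measure ℝ) (m s : ℝ) (ε : ℝ≥0∞) (l : ℝ) : Prop where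
  isQuantile : EqOn (quantile (lawOf (hDown g F m s l))) (hDown g F m s l) (Ioo 0 1)
  unique : bestCaseSet g F m s ε = {lawOf (hDown g F m s l)}
  value : riskMeasure g (lawOf (hDown g F m s l)) =
    m - s * std (weight g) * corr (weight g) (kDown g F l)
  optimal : bestCaseValue g F m s ε = (riskMeasure g (lawOf (hDown g F m s l)) : EReal)

end DistortionBounds

namespace DistortionBounds

open ProbabilityTheory
open scoped RealInnerProductSpace

/-! Quantile functions turn the problem into geometry in `L²(0,1)`. A law `G` with the prescribed
moments corresponds to its centred quantile function `w`, a vector of norm `σ` in the closed convex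
cone `C` (`monoCone`) of centred non-decreasing functions. Write `q` and `γ₀` for the centred
versions of `F⁻¹` and `γ`. Fubini and `∫ γ = 1` give `H_g(G) = μ + ⟪γ₀, w⟫`
(`HasMoments.riskMeasure_eq`). The quantile coupling is optimal (`wasserstein_eq`), so the
Wasserstein ball becomes a lower bound on the cosine of the angle between `q` and `w`
(`HasMoments.wasserstein_eq`). What remains is to minimise a linear functional over the vectors of
`C` of norm `σ` within a given angle of `q`.

Let `m l` be the projection of `l q - γ₀` onto `C`; it is the centred version of `-k_l`. Moreau's
inequality and Cauchy–Schwarz give `⟪γ₀, w⟫ ≥ l ⟪q, w⟫ - ‖m l‖ ‖w‖` on `C`, with equality only on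
the ray of `m l`. So for `l ≥ 0` the rescaled `m l` is the unique minimiser for the angle that it
makes with `q` (`ConePath.inner_le_of_norm_eq`). For `l > 0` the cosine of this angle is continuous
and non-decreasing, and it tends to `1` as `l → ∞`; hence every value between `c₀` and `1` is
reached.

Uniqueness of `l` is the delicate point (`ConePath.cosine_eq_of_lt`). If the cosine agrees at two
parameters, the projections there lie on one ray, spanned by `x`, and the residuals differ by a
positive multiple of `q - α x`. Both residuals integrate to zero over the superlevel sets of `x`, so
`q - α x` does too, and this puts it in the dual cone of `C` (`plateau_nonneg`). The projection then
stays on the ray of `x` for all smaller positive parameters, and the common cosine is `c₀`.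

For `ε ≥ ε*` the distance constraint is not active. If `m 0 ≠ 0`, the parameter `l = 0` solves the
problem. If `m 0 = 0`, then `γ₀` is nonnegative on `C`, and the values along the path decrease to
the bound `μ`. Pairing `γ₀` with the step at `1 - x` gives `g x - x`. A zero of this in `(0,1)`
yields, by compactness-free Hilbert space convergence of `m l / l`, an optimal direction
(`ConePath.exists_limit_direction`). Without a zero, `g > id` on `(0,1)` and the bound is strict for
every nondegenerate law (`lt_riskMeasure`). -/

instance : IsProbabilityMeasure unif := ⟨by simp [unif]⟩

instance : NullSingletonClass unif := by unfold unif; infer_instance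

/-! ### The uniform law and quantile functions -/

theorem ae_mem_Ioo : ∀ᵐ u ∂unif, u ∈ Ioo (0 : ℝ) 1 :=
  ae_restrict_mem measurableSet_Ioo

theorem eqOn_ae {f h : ℝ → ℝ} (H : EqOn f h (Ioo 0 1)) : f =ᵐ[unif] h :=
  ae_mem_Ioo.mono fun _ hu => H hu

theorem unif_Iic {a : ℝ} (h1 : a ≤ 1) : unif (Iic a) = ENNReal.ofReal a := by
  have : unif (Iic a) = unif (Ioc 0 a) := by
    apply measure_congr
    filter_upwards [ae_mem_Ioo] with u hu
    have : (u ∈ Iic a) = (u ∈ Ioc 0 a) := by simp [hu.1]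
    exact this
  rw [this, unif, restrict_Ioo_eq_restrict_Ioc, Measure.restrict_apply measurableSet_Ioc,
    inter_eq_left.2 (Ioc_subset_Ioc_right h1), Real.volume_Ioc, sub_zero]

/-- Right continuity of the distribution function makes the defining infimum attained. This Galois
connection is the source of all other properties of quantiles used here. -/
theorem quantile_le_iff (G : Measure ℝ) {u : ℝ} (hu : u ∈ Ioo (0 : ℝ) 1) (y : ℝ) :
    quantile G u ≤ y ↔ u ≤ cdf G y := by
  set S := {y : ℝ | u ≤ cdf G y} with hS
  have hne : S.Nonempty := by
    obtain ⟨z, hz⟩ := ((tendsto_cdf_atTop G).eventually (lt_mem_nhds hu.2)).exists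
    exact ⟨z, hz.le⟩
  have hbdd : BddBelow S := by
    obtain ⟨z, hz⟩ := ((tendsto_cdf_atBot G).eventually (gt_mem_nhds hu.1)).exists
    refine ⟨z, fun w hw => ?_⟩
    by_contra hlt
    have h1 : u ≤ cdf G w := hw
    exact absurd (h1.trans (monotone_cdf G (not_le.1 hlt).le)) (not_le.2 hz)
  refine ⟨fun h => ?_, fun h => csInf_le hbdd h⟩
  have hgt : ∀ z, y < z → u ≤ cdf G z := by
    intro z hz
    obtain ⟨w, hw, hwz⟩ := exists_lt_of_csInf_lt hne (lt_of_le_of_lt h hz)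
    exact le_trans hw (monotone_cdf G hwz.le)
  have hc : Tendsto (cdf G) (𝓝[>] y) (𝓝 (cdf G y)) :=
    ((cdf G).right_continuous y).mono_left (nhdsWithin_mono _ Ioi_subset_Ici_self)
  exact ge_of_tendsto hc (eventually_mem_nhdsWithin.mono fun z hz => hgt z hz)

theorem lt_quantile_iff (G : Measure ℝ) {u : ℝ} (hu : u ∈ Ioo (0 : ℝ) 1) (y : ℝ) :
    y < quantile G u ↔ cdf G y < u := by
  rw [← not_le, quantile_le_iff G hu, not_le]

theorem monotoneOn_quantile (G : Measure ℝ) : MonotoneOn (quantile G) (Ioo 0 1) := by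
  intro u hu v hv huv
  rw [quantile_le_iff G hu]
  exact huv.trans ((quantile_le_iff G hv _).1 le_rfl)

theorem leftCont_quantile (G : Measure ℝ) {u : ℝ} (hu : u ∈ Ioo (0 : ℝ) 1) :
    ContinuousWithinAt (quantile G) (Iic u) u := by
  have hmem : ∀ᶠ v in 𝓝[≤] u, v ∈ Ioo (0 : ℝ) 1 :=
    nhdsWithin_le_nhds (Ioo_mem_nhds hu.1 hu.2)
  refine tendsto_order.2 ⟨fun y hy => ?_, fun y hy => ?_⟩
  · rw [lt_quantile_iff G hu] at hy
    filter_upwards [hmem, nhdsWithin_le_nhds (lt_mem_nhds hy)] with v hv hyv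
    rwa [lt_quantile_iff G hv]
  · filter_upwards [hmem, eventually_mem_nhdsWithin] with v hv hvu
    exact lt_of_le_of_lt (monotoneOn_quantile G hv hu hvu) hy

theorem aemeasurable_of_monotoneOn {w : ℝ → ℝ} (hw : MonotoneOn w (Ioo 0 1)) :
    AEMeasurable w unif :=
  aemeasurable_restrict_of_monotoneOn measurableSet_Ioo hw

theorem lawOf_quantile (G : Measure ℝ) [IsProbabilityMeasure G] : lawOf (quantile G) = G := by
  have hm := aemeasurable_of_monotoneOn (monotoneOn_quantile G)
  have : IsProbabilityMeasure (lawOf (quantile G)) := Measure.isProbabilityMeasure_map hm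
  refine Measure.ext_of_Iic _ _ fun y => ?_
  rw [lawOf, Measure.map_apply_of_aemeasurable hm measurableSet_Iic, ← ofReal_cdf,
    ← unif_Iic (cdf_le_one G y)]
  apply measure_congr
  filter_upwards [ae_mem_Ioo] with u hu
  exact propext (quantile_le_iff G hu y)

theorem isProbabilityMeasure_lawOf {w : ℝ → ℝ} (hw : AEMeasurable w unif) :
    IsProbabilityMeasure (lawOf w) := Measure.isProbabilityMeasure_map hw

theorem cdf_lawOf {w : ℝ → ℝ} (hw : AEMeasurable w unif) (y : ℝ) :
    cdf (lawOf w) y = unif.real (w ⁻¹' Iic y) := by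
  have := isProbabilityMeasure_lawOf hw
  rw [cdf_eq_real, measureReal_def, lawOf, Measure.map_apply_of_aemeasurable hw measurableSet_Iic,
    measureReal_def]

theorem real_unif_Iic {a : ℝ} (h0 : 0 ≤ a) (h1 : a ≤ 1) : unif.real (Iic a) = a := by
  rw [measureReal_def, unif_Iic h1, ENNReal.toReal_ofReal h0]

theorem quantile_lawOf_le {w : ℝ → ℝ} (hw : MonotoneOn w (Ioo 0 1)) {u : ℝ}
    (hu : u ∈ Ioo (0 : ℝ) 1) : quantile (lawOf w) u ≤ w u := by
  have hm := aemeasurable_of_monotoneOn hw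
  rw [quantile_le_iff _ hu, cdf_lawOf hm]
  refine (real_unif_Iic hu.1.le hu.2.le).symm.le.trans
    (ENNReal.toReal_mono (measure_ne_top _ _) (measure_mono_ae ?_))
  filter_upwards [ae_mem_Ioo] with v hv hvu
  exact hw hv hu hvu

theorem le_quantile_lawOf {w : ℝ → ℝ} (hw : MonotoneOn w (Ioo 0 1)) {u v : ℝ}
    (hu : u ∈ Ioo (0 : ℝ) 1) (hv : v ∈ Ioo (0 : ℝ) 1) (hvu : v < u) :
    w v ≤ quantile (lawOf w) u := by
  have hm := aemeasurable_of_monotoneOn hw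
  by_contra hlt
  rw [not_le] at hlt
  obtain ⟨x, hx1, hx2⟩ := exists_between hlt
  have h1 := (quantile_le_iff (lawOf w) hu x).1 hx1.le
  rw [cdf_lawOf hm] at h1
  have h2 : unif.real (w ⁻¹' Iic x) ≤ unif.real (Iic v) := by
    refine ENNReal.toReal_mono (measure_ne_top _ _) (measure_mono_ae ?_)
    filter_upwards [ae_mem_Ioo] with z hz hzx
    by_contra hvz
    have hvz' : v < z := not_le.1 hvz
    exact absurd (hx2.trans_le (hw hv hz hvz'.le)) (not_lt.2 hzx)
  rw [real_unif_Iic hv.1.le hv.2.le] at h2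
  linarith

/-- The quantile at `u` is squeezed between the values of `w` at points `v < u` and `w u`; left
continuity closes the gap. -/
theorem quantile_lawOf_eqOn {w : ℝ → ℝ} (hw : MonotoneOn w (Ioo 0 1))
    (hc : ∀ u ∈ Ioo (0 : ℝ) 1, ContinuousWithinAt w (Iic u) u) :
    EqOn (quantile (lawOf w)) w (Ioo 0 1) := by
  intro u hu
  refine le_antisymm (quantile_lawOf_le hw hu) ?_
  have h1 : Tendsto w (𝓝[<] u) (𝓝 (w u)) := (hc u hu).mono_left (nhdsWithin_mono _ Iio_subset_Iic_self)
  refine le_of_tendsto h1 ?_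
  filter_upwards [nhdsWithin_le_nhds (Ioo_mem_nhds hu.1 hu.2), eventually_mem_nhdsWithin] with v hv hvu
  exact le_quantile_lawOf hw hu hv hvu

/-- The same squeeze works at every continuity point, and a monotone function has only countably
many discontinuities. This supplies left-continuous versions of monotone functions. -/
theorem quantile_lawOf_ae {w : ℝ → ℝ} (hw : MonotoneOn w (Ioo 0 1)) :
    quantile (lawOf w) =ᵐ[unif] w := by
  have hcount := hw.countable_not_continuousWithinAt
  have h0 : ∀ᵐ u ∂unif, u ∉ {x ∈ Ioo (0 : ℝ) 1 | ¬ContinuousWithinAt w (Ioo 0 1) x} :=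
    measure_eq_zero_iff_ae_notMem.1 (hcount.measure_zero _)
  filter_upwards [h0, ae_mem_Ioo] with u h hu
  have hc : ContinuousAt w u := by
    by_contra hn
    exact h ⟨hu, fun hw' => hn (hw'.continuousAt (Ioo_mem_nhds hu.1 hu.2))⟩
  refine le_antisymm (quantile_lawOf_le hw hu) ?_
  have h1 : Tendsto w (𝓝[<] u) (𝓝 (w u)) := hc.mono_left nhdsWithin_le_nhds
  refine le_of_tendsto h1 ?_
  filter_upwards [nhdsWithin_le_nhds (Ioo_mem_nhds hu.1 hu.2), eventually_mem_nhdsWithin] with v hv hvu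
  exact le_quantile_lawOf hw hu hv hvu

theorem lawOf_congr {w w' : ℝ → ℝ} (h : w =ᵐ[unif] w') : lawOf w = lawOf w' :=
  Measure.map_congr h

/-- Monotone left-continuous functions that agree almost everywhere agree on `(0,1)`. -/
theorem eqOn_of_ae_eq {w w' : ℝ → ℝ} (hw : MonotoneOn w (Ioo 0 1))
    (hc : ∀ u ∈ Ioo (0 : ℝ) 1, ContinuousWithinAt w (Iic u) u) (hw' : MonotoneOn w' (Ioo 0 1))
    (hc' : ∀ u ∈ Ioo (0 : ℝ) 1, ContinuousWithinAt w' (Iic u) u) (h : w =ᵐ[unif] w') :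
    EqOn w w' (Ioo 0 1) := fun u hu => by
  rw [← quantile_lawOf_eqOn hw hc hu, lawOf_congr h, quantile_lawOf_eqOn hw' hc' hu]

/-! ### Optimality of the quantile coupling for the quadratic cost -/

/-- The triangle `{(s, t) | x ≤ s ≤ t < y}`. -/
def triangle (x y : ℝ) : Set (ℝ × ℝ) := {z | x ≤ z.1 ∧ z.1 ≤ z.2 ∧ z.2 < y}

theorem measurableSet_triangle (x y : ℝ) : MeasurableSet (triangle x y) := by
  have h1 : MeasurableSet {z : ℝ × ℝ | x ≤ z.1} := measurableSet_le measurable_const measurable_fst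
  have h2 : MeasurableSet {z : ℝ × ℝ | z.1 ≤ z.2} := measurableSet_le measurable_fst measurable_snd
  have h3 : MeasurableSet {z : ℝ × ℝ | z.2 < y} := measurableSet_lt measurable_snd measurable_const
  exact h1.inter (h2.inter h3)

theorem volume_triangle {x y : ℝ} (h : x ≤ y) :
    2 * volume (triangle x y) = ENNReal.ofReal ((x - y) ^ 2) := by
  -- The section at the left endpoint `s = x` is split off as a null term, so that the rest lives on
  -- `Ioc x y` and becomes an interval integral.
  have hs : ∀ s : ℝ, volume (Prod.mk s ⁻¹' triangle x y)
      = (Ioc x y).indicator (fun s => ENNReal.ofReal (y - s)) s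
        + ({x} : Set ℝ).indicator (fun s => ENNReal.ofReal (y - s)) s := by
    intro s
    by_cases hx : x ≤ s
    · have : Prod.mk s ⁻¹' triangle x y = Ico s y := by
        ext t; simp [triangle, hx]
      rw [this, Real.volume_Ico]
      rcases eq_or_lt_of_le hx with rfl | hx'
      · simp
      · by_cases hy : s ≤ y
        · simp [hx', hy, hx'.ne']
        · simp [hx', hy, hx'.ne', (not_le.1 hy).le]
    · have : Prod.mk s ⁻¹' triangle x y = ∅ := by
        ext t; simp [triangle, hx]
      have h1 : s ∉ Ioc x y := fun h' => hx h'.1.le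
      have h2 : s ∉ ({x} : Set ℝ) := fun h' => hx (by simp_all)
      rw [this, indicator_of_notMem h1, indicator_of_notMem h2]; simp
  have hint : IntegrableOn (fun s => y - s) (Ioc x y) :=
    (continuous_const.sub continuous_id).integrableOn_Ioc
  rw [Measure.volume_eq_prod, Measure.prod_apply (measurableSet_triangle x y)]
  simp_rw [hs]
  rw [lintegral_add_right _ ((by fun_prop : Measurable fun s : ℝ => ENNReal.ofReal (y - s)).indicator
    (measurableSet_singleton x)), lintegral_indicator measurableSet_Ioc,
    lintegral_indicator (measurableSet_singleton x), Measure.restrict_singleton]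
  simp only [Real.volume_singleton, zero_smul, lintegral_zero_measure, add_zero]
  rw [← ofReal_integral_eq_lintegral_ofReal hint
    ((ae_restrict_mem measurableSet_Ioc).mono fun s hs' => sub_nonneg.2 hs'.2),
    ← intervalIntegral.integral_of_le h]
  have : ∫ s in x..y, (y - s) = (x - y) ^ 2 / 2 := by
    rw [intervalIntegral.integral_sub (by simp) (by simp), integral_id]
    simp; ring
  rw [this, show (2 : ℝ≥0∞) = ENNReal.ofReal 2 by simp, ← ENNReal.ofReal_mul (by norm_num)]
  congr 1; ring

theorem triangle_eq_empty {x y : ℝ} (h : y ≤ x) : triangle x y = ∅ := by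
  ext z
  simp only [triangle, mem_ofPred_eq, mem_empty_iff_false, iff_false, not_and, not_lt]
  intro h1 h2; linarith

theorem ofReal_sq_sub_eq (x y : ℝ) : ENNReal.ofReal ((x - y) ^ 2)
    = 2 * (volume (triangle x y) + volume (triangle y x)) := by
  rcases le_total x y with h | h
  · rw [triangle_eq_empty h, measure_empty, add_zero, volume_triangle h]
  · rw [triangle_eq_empty h, measure_empty, zero_add, volume_triangle h, ← neg_sub, neg_sq]

theorem measurableSet_triangle_rel :
    MeasurableSet {v : (ℝ × ℝ) × (ℝ × ℝ) | v.2 ∈ triangle v.1.1 v.1.2} := by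
  have h1 : MeasurableSet {v : (ℝ × ℝ) × (ℝ × ℝ) | v.1.1 ≤ v.2.1} :=
    measurableSet_le (by fun_prop) (by fun_prop)
  have h2 : MeasurableSet {v : (ℝ × ℝ) × (ℝ × ℝ) | v.2.1 ≤ v.2.2} :=
    measurableSet_le (by fun_prop) (by fun_prop)
  have h3 : MeasurableSet {v : (ℝ × ℝ) × (ℝ × ℝ) | v.2.2 < v.1.2} :=
    measurableSet_lt (by fun_prop) (by fun_prop)
  exact h1.inter (h2.inter h3)

theorem lintegral_volume_triangle (π : Measure (ℝ × ℝ)) [SFinite π] :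
    ∫⁻ p, volume (triangle p.1 p.2) ∂π = ∫⁻ z, π {p | z ∈ triangle p.1 p.2} := by
  have hm := measurableSet_triangle_rel
  exact (Measure.prod_apply (μ := π) (ν := volume) hm).symm.trans
    (Measure.prod_apply_symm (μ := π) (ν := volume) hm)

/-- The quadratic transport cost of a coupling in terms of the probabilities
`π (p.1 ≤ s, t < p.2)` and `π (p.2 ≤ s, t < p.1)` for `s ≤ t`. -/
theorem lintegral_sq_sub (π : Measure (ℝ × ℝ)) [SFinite π] :
    ∫⁻ p, ENNReal.ofReal ((p.1 - p.2) ^ 2) ∂π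
      = 2 * ((∫⁻ z, π {p | z ∈ triangle p.1 p.2}) + ∫⁻ z, π {p | z ∈ triangle p.2 p.1}) := by
  have hm1 : Measurable fun p : ℝ × ℝ => volume (triangle p.1 p.2) :=
    measurable_measure_prodMk_left measurableSet_triangle_rel
  have hm2 : Measurable fun p : ℝ × ℝ => volume (triangle p.2 p.1) := hm1.comp measurable_swap
  simp_rw [ofReal_sq_sub_eq]
  rw [lintegral_const_mul 2 (by exact hm1.add hm2), lintegral_add_left hm1, lintegral_volume_triangle]
  have h := lintegral_volume_triangle (π.map Prod.swap)
  rw [lintegral_map hm1 measurable_swap] at h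
  congr 2
  simp only [Prod.fst_swap, Prod.snd_swap] at h
  rw [h]
  refine lintegral_congr fun z => ?_
  rw [Measure.map_apply measurable_swap]
  · rfl
  · exact measurable_prodMk_right measurableSet_triangle_rel

/-- The subtraction is truncated in `ℝ≥0∞`: this is the lower Fréchet bound, valid for every
coupling. -/
theorem coupling_inter_ge {π : Measure (ℝ × ℝ)} {G₁ G₂ : Measure ℝ}
    (h1 : π.map Prod.fst = G₁) (h2 : π.map Prod.snd = G₂) (s t : ℝ) :
    G₁ (Iic s) - G₂ (Iic t) ≤ π (Prod.fst ⁻¹' Iic s \ Prod.snd ⁻¹' Iic t) := by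
  rw [← h1, ← h2, Measure.map_apply measurable_fst measurableSet_Iic,
    Measure.map_apply measurable_snd measurableSet_Iic]
  exact le_measure_sdiff

/-- For the quantile coupling both events are, up to null sets, initial intervals of `(0,1)`, hence
nested, and the lower bound of `coupling_inter_ge` becomes an equality. -/
theorem comonotone_inter (G₁ G₂ : Measure ℝ) [IsProbabilityMeasure G₁] [IsProbabilityMeasure G₂]
    (s t : ℝ) : unif (quantile G₁ ⁻¹' Iic s \ quantile G₂ ⁻¹' Iic t)
      = G₁ (Iic s) - G₂ (Iic t) := by
  have : unif (quantile G₁ ⁻¹' Iic s \ quantile G₂ ⁻¹' Iic t)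
      = unif (Iic (cdf G₁ s) \ Iic (cdf G₂ t)) := by
    apply measure_congr
    filter_upwards [ae_mem_Ioo] with u hu
    refine propext (and_congr (quantile_le_iff G₁ hu s) (not_congr (quantile_le_iff G₂ hu t)))
  rw [this, ← ofReal_cdf, ← ofReal_cdf]
  rcases le_total (cdf G₁ s) (cdf G₂ t) with h | h
  · rw [sdiff_eq_empty.2 (Iic_subset_Iic.2 h), measure_empty,
      tsub_eq_zero_of_le (ENNReal.ofReal_le_ofReal h)]
  · rw [measure_sdiff (Iic_subset_Iic.2 h) measurableSet_Iic.nullMeasurableSet (measure_ne_top _ _),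
      unif_Iic (cdf_le_one _ _), unif_Iic (cdf_le_one _ _)]

/-- By `lintegral_sq_sub` the cost is an integral of probabilities of the form `π (X ≤ s, t < Y)`
and their mirror images. The quantile coupling minimises all of these simultaneously, so no
existence theorem for optimal plans is needed. -/
theorem wasserstein_eq (G₁ G₂ : Measure ℝ) [IsProbabilityMeasure G₁] [IsProbabilityMeasure G₂] :
    wasserstein G₁ G₂
      = (∫⁻ u, ENNReal.ofReal ((quantile G₁ u - quantile G₂ u) ^ 2) ∂unif) ^ (1 / 2 : ℝ) := by
  have hq1 := aemeasurable_of_monotoneOn (monotoneOn_quantile G₁)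
  have hq2 := aemeasurable_of_monotoneOn (monotoneOn_quantile G₂)
  have hq := hq1.prodMk hq2
  set π₀ := unif.map fun u => (quantile G₁ u, quantile G₂ u) with hπ₀
  have hπ1 : π₀.map Prod.fst = G₁ := by
    rw [hπ₀, AEMeasurable.map_map_of_aemeasurable measurable_fst.aemeasurable hq]
    exact lawOf_quantile G₁
  have hπ2 : π₀.map Prod.snd = G₂ := by
    rw [hπ₀, AEMeasurable.map_map_of_aemeasurable measurable_snd.aemeasurable hq]
    exact lawOf_quantile G₂
  have hcost : ∫⁻ p, ENNReal.ofReal ((p.1 - p.2) ^ 2) ∂π₀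
      = ∫⁻ u, ENNReal.ofReal ((quantile G₁ u - quantile G₂ u) ^ 2) ∂unif := by
    rw [hπ₀, lintegral_map' (by fun_prop) hq]
  rw [← hcost]
  refine le_antisymm (iInf₂_le π₀ ⟨hπ1, hπ2⟩) (le_iInf₂ fun π hπ => ?_)
  have hprob : IsProbabilityMeasure π := by
    constructor
    have := congrArg (fun ν => ν univ) hπ.1
    simpa [Measure.map_apply measurable_fst MeasurableSet.univ] using this
  have hπ₀p : IsProbabilityMeasure π₀ := Measure.isProbabilityMeasure_map hq
  refine ENNReal.rpow_le_rpow ?_ (by norm_num)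
  rw [lintegral_sq_sub, lintegral_sq_sub]
  gcongr 2 * (?_ + ?_)
  · refine lintegral_mono fun z => ?_
    by_cases hz : z.1 ≤ z.2
    · have hset : {p : ℝ × ℝ | z ∈ triangle p.1 p.2}
          = Prod.fst ⁻¹' Iic z.1 \ Prod.snd ⁻¹' Iic z.2 := by
        ext p; simp [triangle, hz]
      simp only [hset]
      refine le_trans (le_of_eq ?_) (coupling_inter_ge hπ.1 hπ.2 z.1 z.2)
      rw [hπ₀, Measure.map_apply_of_aemeasurable hq
        ((measurable_fst measurableSet_Iic).diff (measurable_snd measurableSet_Iic)),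
        ← comonotone_inter]
      rfl
    · have hset : {p : ℝ × ℝ | z ∈ triangle p.1 p.2} = ∅ := by
        ext p; simp [triangle, hz]
      simp [hset]
  · refine lintegral_mono fun z => ?_
    by_cases hz : z.1 ≤ z.2
    · have hset : {p : ℝ × ℝ | z ∈ triangle p.2 p.1}
          = Prod.snd ⁻¹' Iic z.1 \ Prod.fst ⁻¹' Iic z.2 := by
        ext p; simp [triangle, hz]
      simp only [hset]
      have hge : G₂ (Iic z.1) - G₁ (Iic z.2) ≤ π (Prod.snd ⁻¹' Iic z.1 \ Prod.fst ⁻¹' Iic z.2) := by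
        rw [← hπ.1, ← hπ.2, Measure.map_apply measurable_fst measurableSet_Iic,
          Measure.map_apply measurable_snd measurableSet_Iic]
        exact le_measure_sdiff
      refine le_trans (le_of_eq ?_) hge
      rw [hπ₀, Measure.map_apply_of_aemeasurable hq
        ((measurable_snd measurableSet_Iic).diff (measurable_fst measurableSet_Iic)),
        ← comonotone_inter]
      rfl
    · have hset : {p : ℝ × ℝ | z ∈ triangle p.2 p.1} = ∅ := by
        ext p; simp [triangle, hz]
      simp [hset]

/-! ### Layer-cake formulas and monotone test functions -/

theorem integrable_prod_indicator {r : ℝ → ℝ} (hr : AEStronglyMeasurable r unif)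
    {S : Set (ℝ × ℝ)} (hS : MeasurableSet S)
    (hfin : ∀ u, volume ((fun x => (x, u)) ⁻¹' S) ≠ ∞)
    (hint : Integrable (fun u => ‖r u‖ * volume.real ((fun x => (x, u)) ⁻¹' S)) unif) :
    Integrable (S.indicator fun z : ℝ × ℝ => r z.2) (volume.prod unif) := by
  have hm : AEStronglyMeasurable (S.indicator fun z : ℝ × ℝ => r z.2) (volume.prod unif) :=
    (hr.comp_snd (μ := volume)).indicator hS
  have hsec : ∀ u, MeasurableSet ((fun x : ℝ => (x, u)) ⁻¹' S) := fun u =>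
    measurable_prodMk_right hS
  have hfun : ∀ u x, S.indicator (fun z : ℝ × ℝ => r z.2) (x, u)
      = ((fun x : ℝ => (x, u)) ⁻¹' S).indicator (fun _ => r u) x := by
    intro u x; rfl
  rw [integrable_prod_iff' hm]
  refine ⟨Eventually.of_forall fun u => ?_, ?_⟩
  · simp_rw [hfun]
    rw [integrable_indicator_iff (hsec u)]
    exact integrableOn_const (hfin u)
  · refine hint.congr (Eventually.of_forall fun u => ?_)
    simp_rw [hfun, norm_indicator_eq_indicator_norm]
    rw [integral_indicator (hsec u), setIntegral_const, smul_eq_mul, mul_comm]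

theorem integral_prod_indicator {r : ℝ → ℝ} (hr : AEStronglyMeasurable r unif)
    {S : Set (ℝ × ℝ)} (hS : MeasurableSet S)
    (hfin : ∀ u, volume ((fun x => (x, u)) ⁻¹' S) ≠ ∞)
    (hint : Integrable (fun u => ‖r u‖ * volume.real ((fun x => (x, u)) ⁻¹' S)) unif) :
    ∫ x, ∫ u, S.indicator (fun z : ℝ × ℝ => r z.2) (x, u) ∂unif
      = ∫ u, r u * volume.real ((fun x => (x, u)) ⁻¹' S) ∂unif := by
  have hI := integrable_prod_indicator hr hS hfin hint
  have hsec : ∀ u, MeasurableSet ((fun x : ℝ => (x, u)) ⁻¹' S) := fun u =>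
    measurable_prodMk_right hS
  rw [integral_integral_swap (f := fun x u => S.indicator (fun z : ℝ × ℝ => r z.2) (x, u)) hI]
  refine integral_congr_ae (Eventually.of_forall fun u => ?_)
  have hfun : ∀ x, S.indicator (fun z : ℝ × ℝ => r z.2) (x, u)
      = ((fun x : ℝ => (x, u)) ⁻¹' S).indicator (fun _ => r u) x := fun x => rfl
  simp_rw [hfun]
  rw [integral_indicator (hsec u), setIntegral_const, smul_eq_mul, mul_comm]

/-- Layer-cake formula for `∫ r w`, for measurable `w`. -/
theorem layer_cake_of_measurable {r w : ℝ → ℝ} (hr : MemLp r 2 unif) (hw : MemLp w 2 unif)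
    (hwm : Measurable w) :
    IntegrableOn (fun x => ∫ u, {u | x < w u}.indicator r u ∂unif) (Ioi 0) ∧
    IntegrableOn (fun x => ∫ u, {u | w u ≤ x}.indicator r u ∂unif) (Iio 0) ∧
    ∫ u, r u * w u ∂unif = (∫ x in Ioi 0, ∫ u, {u | x < w u}.indicator r u ∂unif)
      - ∫ x in Iio 0, ∫ u, {u | w u ≤ x}.indicator r u ∂unif := by
  -- `S` and `T` are the regions between the axis and the graph of `w`; their sections over `u` have
  -- lengths `w⁺` and `w⁻`, and Fubini is applied to `r` on each.
  set S : Set (ℝ × ℝ) := {z | 0 < z.1 ∧ z.1 < w z.2} with hS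
  set T : Set (ℝ × ℝ) := {z | w z.2 ≤ z.1 ∧ z.1 < 0} with hT
  have hSm : MeasurableSet S :=
    (measurableSet_lt measurable_const measurable_fst).inter
      (measurableSet_lt measurable_fst (hwm.comp measurable_snd))
  have hTm : MeasurableSet T :=
    (measurableSet_le (hwm.comp measurable_snd) measurable_fst).inter
      (measurableSet_lt measurable_fst measurable_const)
  have hSs : ∀ u, (fun x => (x, u)) ⁻¹' S = Ioo 0 (w u) := fun u => by ext x; simp [S]
  have hTs : ∀ u, (fun x => (x, u)) ⁻¹' T = Ico (w u) 0 := fun u => by ext x; simp [T]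
  have hSv : ∀ u, volume.real ((fun x => (x, u)) ⁻¹' S) = max (w u) 0 := fun u => by
    rw [hSs, measureReal_def, Real.volume_Ioo, ENNReal.toReal_ofReal', sub_zero]
  have hTv : ∀ u, volume.real ((fun x => (x, u)) ⁻¹' T) = max (-w u) 0 := fun u => by
    rw [hTs, measureReal_def, Real.volume_Ico, ENNReal.toReal_ofReal', zero_sub]
  have hSf : ∀ u, volume ((fun x => (x, u)) ⁻¹' S) ≠ ∞ := fun u => by rw [hSs]; simp
  have hTf : ∀ u, volume ((fun x => (x, u)) ⁻¹' T) ≠ ∞ := fun u => by rw [hTs]; simp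
  have hp : MemLp (fun u => max (w u) 0) 2 unif := hw.pos_part
  have hn : MemLp (fun u => max (-w u) 0) 2 unif := hw.neg_part
  have hSi : Integrable (fun u => ‖r u‖ * volume.real ((fun x => (x, u)) ⁻¹' S)) unif := by
    simp_rw [hSv]; exact hr.norm.integrable_mul hp
  have hTi : Integrable (fun u => ‖r u‖ * volume.real ((fun x => (x, u)) ⁻¹' T)) unif := by
    simp_rw [hTv]; exact hr.norm.integrable_mul hn
  have hSx : (fun x => ∫ u, S.indicator (fun z : ℝ × ℝ => r z.2) (x, u) ∂unif)
      = (Ioi 0).indicator fun x => ∫ u, {u | x < w u}.indicator r u ∂unif := by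
    ext x
    by_cases hx : x ∈ Ioi (0 : ℝ)
    · rw [indicator_of_mem hx]
      congr 1; ext u
      by_cases h : x < w u
      · rw [indicator_of_mem (show (x, u) ∈ S from ⟨hx, h⟩),
          indicator_of_mem (show u ∈ {u | x < w u} from h)]
      · rw [indicator_of_notMem (fun h' : (x, u) ∈ S => h h'.2),
          indicator_of_notMem (fun h' : u ∈ {u | x < w u} => h h')]
    · rw [indicator_of_notMem hx]
      have : ∀ u, S.indicator (fun z : ℝ × ℝ => r z.2) (x, u) = 0 := fun u =>
        indicator_of_notMem (fun h' : (x, u) ∈ S => hx h'.1) _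
      simp [this]
  have hTx : (fun x => ∫ u, T.indicator (fun z : ℝ × ℝ => r z.2) (x, u) ∂unif)
      = (Iio 0).indicator fun x => ∫ u, {u | w u ≤ x}.indicator r u ∂unif := by
    ext x
    by_cases hx : x ∈ Iio (0 : ℝ)
    · rw [indicator_of_mem hx]
      congr 1; ext u
      by_cases h : w u ≤ x
      · rw [indicator_of_mem (show (x, u) ∈ T from ⟨h, hx⟩),
          indicator_of_mem (show u ∈ {u | w u ≤ x} from h)]
      · rw [indicator_of_notMem (fun h' : (x, u) ∈ T => h h'.1),
          indicator_of_notMem (fun h' : u ∈ {u | w u ≤ x} => h h')]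
    · rw [indicator_of_notMem hx]
      have : ∀ u, T.indicator (fun z : ℝ × ℝ => r z.2) (x, u) = 0 := fun u =>
        indicator_of_notMem (fun h' : (x, u) ∈ T => hx h'.2) _
      simp [this]
  have h1 := integral_prod_indicator hr.1 hSm hSf hSi
  have h2 := integral_prod_indicator hr.1 hTm hTf hTi
  have i1 := (integrable_prod_indicator hr.1 hSm hSf hSi).integral_prod_left
  have i2 := (integrable_prod_indicator hr.1 hTm hTf hTi).integral_prod_left
  rw [hSx] at i1
  rw [hTx] at i2
  rw [hSx, integral_indicator measurableSet_Ioi] at h1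
  rw [hTx, integral_indicator measurableSet_Iio] at h2
  refine ⟨(integrable_indicator_iff measurableSet_Ioi).1 i1,
    (integrable_indicator_iff measurableSet_Iio).1 i2, ?_⟩
  rw [h1, h2]
  simp_rw [hSv, hTv]
  rw [← integral_sub (f := fun u => r u * max (w u) 0) (g := fun u => r u * max (-w u) 0)
    (hr.integrable_mul hp) (hr.integrable_mul hn)]
  refine integral_congr_ae (Eventually.of_forall fun u => ?_)
  simp only [← mul_sub]
  congr 1
  rcases le_total (w u) 0 with h | h
  · rw [max_eq_right h, max_eq_left (neg_nonneg.2 h)]; ring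
  · rw [max_eq_left h, max_eq_right (neg_nonpos.2 h)]; ring

/-- Layer-cake formula for `∫ r w`. -/
theorem layer_cake {r w : ℝ → ℝ} (hr : MemLp r 2 unif) (hw : MemLp w 2 unif) :
    IntegrableOn (fun x => ∫ u, {u | x < w u}.indicator r u ∂unif) (Ioi 0) ∧
    IntegrableOn (fun x => ∫ u, {u | w u ≤ x}.indicator r u ∂unif) (Iio 0) ∧
    ∫ u, r u * w u ∂unif = (∫ x in Ioi 0, ∫ u, {u | x < w u}.indicator r u ∂unif)
      - ∫ x in Iio 0, ∫ u, {u | w u ≤ x}.indicator r u ∂unif := by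
  -- A measurable representative is required because the regions under the graph must be measurable
  -- in the product.
  set w' := hw.1.mk w with hw'
  have hww' : w =ᵐ[unif] w' := hw.1.ae_eq_mk
  have h := layer_cake_of_measurable hr ((memLp_congr_ae hww').1 hw)
    hw.1.stronglyMeasurable_mk.measurable
  have e1 : ∀ x : ℝ, ∫ u, {u | x < w u}.indicator r u ∂unif
      = ∫ u, {u | x < w' u}.indicator r u ∂unif := fun x => by
    refine integral_congr_ae ?_
    filter_upwards [hww'] with u hu
    simp only [indicator, mem_ofPred_eq, hu]
  have e2 : ∀ x : ℝ, ∫ u, {u | w u ≤ x}.indicator r u ∂unif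
      = ∫ u, {u | w' u ≤ x}.indicator r u ∂unif := fun x => by
    refine integral_congr_ae ?_
    filter_upwards [hww'] with u hu
    simp only [indicator, mem_ofPred_eq, hu]
  have e3 : ∫ u, r u * w u ∂unif = ∫ u, r u * w' u ∂unif := by
    refine integral_congr_ae ?_
    filter_upwards [hww'] with u hu
    rw [hu]
  simp_rw [e1, e2, e3]
  exact h

theorem MemLp.integrable_unif {r : ℝ → ℝ} (hr : MemLp r 2 unif) : Integrable r unif :=
  hr.integrable (by norm_num)

/-- A square-integrable function whose upper tail integrals are nonnegative and whose integral
vanishes has a nonnegative scalar product with every non-decreasing function. -/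
theorem integral_mul_nonneg_of_tail {r w : ℝ → ℝ} (hr : MemLp r 2 unif) (hw : MemLp w 2 unif)
    (hmono : MonotoneOn w (Ioo 0 1)) (h0 : ∫ u, r u ∂unif = 0)
    (htail : ∀ a ∈ Ioo (0 : ℝ) 1, 0 ≤ ∫ u in Ioi a, r u ∂unif) :
    0 ≤ ∫ u, r u * w u ∂unif := by
  have hi := MemLp.integrable_unif hr
  have key : ∀ x : ℝ, 0 ≤ ∫ u, {u | x < w u}.indicator r u ∂unif := by
    intro x
    set A := {u ∈ Ioo (0 : ℝ) 1 | x < w u} with hA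
    rcases A.eq_empty_or_nonempty with he | hne
    · rw [integral_eq_zero_of_ae]
      filter_upwards [ae_mem_Ioo] with u hu
      have : u ∉ {u | x < w u} := fun h => by
        have : u ∈ A := ⟨hu, h⟩
        simp [he] at this
      rw [indicator_of_notMem this]; rfl
    · have hbdd : BddBelow A := ⟨0, fun u hu => hu.1.1.le⟩
      -- The superlevel set of a monotone function is an upper interval with left end `a`, up to the
      -- endpoint, so its integral is one of the given tails (or the full integral when `a = 0`).
      set a := sInf A with ha
      have ha0 : 0 ≤ a := le_csInf hne fun u hu => hu.1.1.le
      have ha1 : a < 1 := by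
        obtain ⟨u, hu⟩ := hne
        exact (csInf_le hbdd hu).trans_lt hu.1.2
      have hae : ∫ u, {u | x < w u}.indicator r u ∂unif = ∫ u, (Ioi a).indicator r u ∂unif := by
        refine integral_congr_ae ?_
        have hna : ∀ᵐ u ∂unif, u ≠ a := by
          have : unif {a} = 0 := measure_singleton a
          exact measure_eq_zero_iff_ae_notMem.1 this
        filter_upwards [ae_mem_Ioo, hna] with u hu hua
        have : u ∈ {u | x < w u} ↔ u ∈ Ioi a := by
          constructor
          · intro h
            exact lt_of_le_of_ne (csInf_le hbdd ⟨hu, h⟩) (Ne.symm hua)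
          · intro h
            obtain ⟨v, hv, hvu⟩ := exists_lt_of_csInf_lt hne h
            exact lt_of_lt_of_le hv.2 (hmono hv.1 hu hvu.le)
        by_cases h : u ∈ Ioi a
        · rw [indicator_of_mem h, indicator_of_mem (this.2 h)]
        · rw [indicator_of_notMem h, indicator_of_notMem (fun h' => h (this.1 h'))]
      rw [hae, integral_indicator measurableSet_Ioi]
      rcases eq_or_lt_of_le ha0 with h | h
      · rw [← h]
        have : ∫ u in Ioi 0, r u ∂unif = ∫ u, r u ∂unif := by
          refine setIntegral_eq_integral_of_ae_compl_eq_zero ?_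
          filter_upwards [ae_mem_Ioo] with u hu hu'
          exact absurd hu.1 hu'
        rw [this, h0]
      · exact htail a ⟨h, ha1⟩
  -- Sublevel sets are complements of superlevel sets and the total integral of `r` is zero, so the
  -- sign flips.
  have key2 : ∀ x : ℝ, ∫ u, {u | w u ≤ x}.indicator r u ∂unif ≤ 0 := by
    intro x
    have hm := aemeasurable_of_monotoneOn hmono
    have hS : NullMeasurableSet {u | x < w u} unif := nullMeasurableSet_lt aemeasurable_const hm
    have hc : ({u | x < w u} : Set ℝ)ᶜ = {u | w u ≤ x} := by ext u; simp
    have h1 := integral_indicator₀ (f := r) hS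
    have h2 := integral_indicator₀ (f := r) hS.compl
    have h3 := integral_add_compl₀ hS hi
    rw [hc] at h2 h3
    have := key x
    linarith
  obtain ⟨-, -, h⟩ := layer_cake hr hw
  rw [h]
  have h1 : 0 ≤ ∫ x in Ioi (0 : ℝ), ∫ u, {u | x < w u}.indicator r u ∂unif :=
    integral_nonneg fun x => key x
  have h2 : ∫ x in Iio (0 : ℝ), ∫ u, {u | w u ≤ x}.indicator r u ∂unif ≤ 0 :=
    integral_nonpos fun x => key2 x
  linarith

theorem setIntegral_compl_Iic {r : ℝ → ℝ} (hr : Integrable r unif) (a : ℝ) :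
    (∫ u in Iic a, r u ∂unif) + ∫ u in Ioi a, r u ∂unif = ∫ u, r u ∂unif := by
  have := integral_add_compl (measurableSet_Iic (a := a)) hr
  rwa [compl_Iic] at this

/-- Centred non-decreasing functions have nonnegative upper tail integrals. -/
theorem tail_nonneg_of_monotoneOn {w : ℝ → ℝ} (hw : Integrable w unif)
    (hmono : MonotoneOn w (Ioo 0 1)) (h0 : ∫ u, w u ∂unif = 0) {a : ℝ} (ha : a ∈ Ioo (0 : ℝ) 1) :
    0 ≤ ∫ u in Ioi a, w u ∂unif := by
  rcases le_total 0 (w a) with h | h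
  · refine setIntegral_nonneg_of_ae_restrict ?_
    filter_upwards [ae_restrict_of_ae ae_mem_Ioo, ae_restrict_mem measurableSet_Ioi] with u hu hau
    exact h.trans (hmono ha hu (le_of_lt hau))
  · have h1 : ∫ u in Iic a, w u ∂unif ≤ 0 := by
      refine setIntegral_nonpos_of_ae_restrict ?_
      filter_upwards [ae_restrict_of_ae ae_mem_Ioo, ae_restrict_mem measurableSet_Iic] with u hu hau
      exact (hmono hu ha hau).trans h
    have := setIntegral_compl_Iic hw a
    linarith

/-- Chebyshev's inequality for the uniform law. -/
theorem integral_mul_nonneg_of_monotoneOn {v w : ℝ → ℝ} (hv : MemLp v 2 unif)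
    (hw : MemLp w 2 unif) (hvm : MonotoneOn v (Ioo 0 1)) (hwm : MonotoneOn w (Ioo 0 1))
    (h0 : ∫ u, v u ∂unif = 0) : 0 ≤ ∫ u, v u * w u ∂unif :=
  integral_mul_nonneg_of_tail hv hw hwm h0 fun _ ha =>
    tail_nonneg_of_monotoneOn (MemLp.integrable_unif hv) hvm h0 ha

/-! ### Distortion functions -/

theorem weight_eq_deriv_ae {g : ℝ → ℝ} (hgac : AbsolutelyContinuousOnInterval g 0 1) :
    ∀ᵐ u ∂(volume : Measure ℝ), u ∈ Icc (0 : ℝ) 1 → weight g u = deriv g (1 - u) := by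
  have h := hgac.ae_differentiableAt
  have hmp : MeasurePreserving (fun u : ℝ => 1 - u) volume volume :=
    Measure.measurePreserving_sub_left volume 1
  have h' := hmp.quasiMeasurePreserving.ae h
  filter_upwards [h'] with u hu hu01
  have hd : DifferentiableAt ℝ g (1 - u) := hu (by
    rw [uIcc_of_le zero_le_one]; exact ⟨by linarith [hu01.2], by linarith [hu01.1]⟩)
  exact hd.derivWithin (uniqueDiffWithinAt_Iio _)

/-- The fundamental theorem of calculus for absolutely continuous functions, after reflecting `u` to
`1 - u`. It is the only place where `γ` is turned back into `g`. -/
theorem integral_weight_Ioi {g : ℝ → ℝ} (hg : IsDistortion g)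
    (hgac : AbsolutelyContinuousOnInterval g 0 1) {a : ℝ} (ha : a ∈ Icc (0 : ℝ) 1) :
    ∫ u in Ioi a, weight g u ∂unif = g (1 - a) := by
  have h1 : ∫ u in Ioi a, weight g u ∂unif = ∫ u in Ioo a 1, weight g u := by
    rw [unif, Measure.restrict_restrict measurableSet_Ioi]
    congr 2
    ext u; simp only [mem_inter_iff, mem_Ioi, mem_Ioo]
    constructor
    · rintro ⟨h, -, h'⟩; exact ⟨h, h'⟩
    · rintro ⟨h, h'⟩; exact ⟨h, ha.1.trans_lt h, h'⟩
  have h2 : ∫ u in Ioo a 1, weight g u = ∫ u in a..1, weight g u := by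
    rw [intervalIntegral.integral_of_le ha.2, integral_Ioc_eq_integral_Ioo]
  have h3 : ∫ u in a..1, weight g u = ∫ u in a..1, deriv g (1 - u) := by
    refine intervalIntegral.integral_congr_ae ?_
    filter_upwards [weight_eq_deriv_ae hgac] with u hu hu'
    rw [uIoc_of_le ha.2] at hu'
    exact hu ⟨ha.1.trans hu'.1.le, hu'.2⟩
  have h4 : AbsolutelyContinuousOnInterval g 0 (1 - a) := hgac.mono (by
    rw [uIcc_of_le (by linarith [ha.2]), uIcc_of_le zero_le_one]
    exact Icc_subset_Icc_right (by linarith [ha.1]))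
  rw [h1, h2, h3, intervalIntegral.integral_comp_sub_left (fun x => deriv g x) 1, sub_self,
    h4.integral_deriv_eq_sub, hg.map_zero, sub_zero]

theorem integral_weight {g : ℝ → ℝ} (hg : IsDistortion g)
    (hgac : AbsolutelyContinuousOnInterval g 0 1) : ∫ u, weight g u ∂unif = 1 := by
  have h := integral_weight_Ioi hg hgac (a := 0) ⟨le_rfl, zero_le_one⟩
  rw [sub_zero, hg.map_one] at h
  rw [← h]
  refine (setIntegral_eq_integral_of_ae_compl_eq_zero ?_).symm
  filter_upwards [ae_mem_Ioo] with u hu hu'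
  exact absurd hu.1 hu'

variable {g : ℝ → ℝ}

theorem integral_weight_indicator_lt (hg : IsDistortion g)
    (hgac : AbsolutelyContinuousOnInterval g 0 1) (G : Measure ℝ) (x : ℝ) :
    ∫ u, {u | x < quantile G u}.indicator (weight g) u ∂unif = g (1 - cdf G x) := by
  rw [← integral_weight_Ioi hg hgac ⟨cdf_nonneg G x, cdf_le_one G x⟩,
    ← integral_indicator measurableSet_Ioi]
  refine integral_congr_ae ?_
  filter_upwards [ae_mem_Ioo] with u hu
  have := lt_quantile_iff G hu x
  simp only [indicator, mem_ofPred_eq, mem_Ioi, this]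

theorem integral_weight_indicator_le (hg : IsDistortion g)
    (hgac : AbsolutelyContinuousOnInterval g 0 1) (hγ : MemLp (weight g) 2 unif)
    (G : Measure ℝ) (x : ℝ) :
    ∫ u, {u | quantile G u ≤ x}.indicator (weight g) u ∂unif = 1 - g (1 - cdf G x) := by
  rw [← integral_weight_Ioi hg hgac ⟨cdf_nonneg G x, cdf_le_one G x⟩, ← integral_weight hg hgac,
    ← setIntegral_compl_Iic (MemLp.integrable_unif hγ) (cdf G x), add_sub_cancel_right,
    ← integral_indicator measurableSet_Iic]
  refine integral_congr_ae ?_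
  filter_upwards [ae_mem_Ioo] with u hu
  have := quantile_le_iff G hu x
  simp only [indicator, mem_ofPred_eq, mem_Iic, this]

/-- The quantile representation of the distortion risk measure. -/
theorem riskMeasure_eq (hg : IsDistortion g)
    (hgac : AbsolutelyContinuousOnInterval g 0 1) (hγ : MemLp (weight g) 2 unif)
    (G : Measure ℝ) (hq : MemLp (quantile G) 2 unif) :
    IntegrableOn (fun x => g (1 - cdf G x)) (Ioi 0) ∧
    IntegrableOn (fun x => 1 - g (1 - cdf G x)) (Iio 0) ∧
    riskMeasure g G = ∫ u, weight g u * quantile G u ∂unif := by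
  have h := layer_cake hγ hq
  simp_rw [integral_weight_indicator_lt hg hgac, integral_weight_indicator_le hg hgac hγ] at h
  refine ⟨h.1, h.2.1, ?_⟩
  rw [h.2.2, riskMeasure]
  ring

/-! ### Projections onto convex cones along a ray -/

section Cone

variable {H : Type*} [NormedAddCommGroup H] [InnerProductSpace ℝ H]

/-- Convex cones with apex `0`. -/
structure IsConvexCone (C : Set H) : Prop where
  zero_mem : (0 : H) ∈ C
  add_mem : ∀ x ∈ C, ∀ y ∈ C, x + y ∈ C
  smul_mem : ∀ x ∈ C, ∀ t : ℝ, 0 ≤ t → t • x ∈ C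

/-- Moreau's characterisation of the metric projection `m` of `f` onto the convex cone `C`. -/
structure IsConeProj (C : Set H) (f m : H) : Prop where
  mem : m ∈ C
  inner_self : ⟪f, m⟫ = ‖m‖ ^ 2
  inner_le : ∀ w ∈ C, ⟪f, w⟫ ≤ ⟪m, w⟫

theorem IsConvexCone.convex {C : Set H} (hC : IsConvexCone C) : Convex ℝ C :=
  fun x hx y hy a b ha hb _ => hC.add_mem _ (hC.smul_mem x hx a ha) _ (hC.smul_mem y hy b hb)

/-- The variational inequality of the projection onto a convex set, tested at `0`, `2 m` and `m +
w`, gives Moreau's conditions. -/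
theorem IsConvexCone.exists_isConeProj [CompleteSpace H] {C : Set H} (hC : IsConvexCone C)
    (hcl : IsClosed C) (f : H) : ∃ m, IsConeProj C f m := by
  obtain ⟨m, hm, hmin⟩ :=
    exists_norm_eq_iInf_of_complete_convex ⟨0, hC.zero_mem⟩ hcl.isComplete hC.convex f
  have h := (norm_eq_iInf_iff_real_inner_le_zero hC.convex hm).1 hmin
  have h0 := h 0 hC.zero_mem
  have h2 := h ((2 : ℝ) • m) (hC.smul_mem m hm 2 (by norm_num))
  have e2 : (2 : ℝ) • m - m = m := by rw [two_smul, add_sub_cancel_right]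
  rw [e2, inner_sub_left] at h2
  rw [zero_sub, inner_neg_right, inner_sub_left] at h0
  refine ⟨m, hm, ?_, fun w hw => ?_⟩
  · rw [← real_inner_self_eq_norm_sq]; linarith
  · have h3 := h (m + w) (hC.add_mem m hm w hw)
    rw [add_sub_cancel_left, inner_sub_left] at h3
    linarith

/-- A Pythagorean inequality: it yields minimality of the projection, and its second term on the
left yields uniqueness. -/
theorem IsConeProj.norm_sub_sq_le {C : Set H} {f m : H} (h : IsConeProj C f m) {w : H}
    (hw : w ∈ C) : ‖f - m‖ ^ 2 + ‖w - m‖ ^ 2 ≤ ‖f - w‖ ^ 2 := by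
  have h1 := h.inner_le w hw
  have h2 := h.inner_self
  rw [norm_sub_sq_real, norm_sub_sq_real, norm_sub_sq_real, real_inner_comm m w]
  linarith

theorem IsConeProj.of_orthogonal {C : Set H} {f m : H} (hm : m ∈ C) (h1 : ⟪f - m, m⟫ = 0)
    (h2 : ∀ w ∈ C, ⟪f - m, w⟫ ≤ 0) : IsConeProj C f m := by
  refine ⟨hm, ?_, fun w hw => ?_⟩
  · rw [inner_sub_left, real_inner_self_eq_norm_sq] at h1; linarith
  · have := h2 w hw
    rw [inner_sub_left] at this; linarith

theorem IsConeProj.unique {C : Set H} {f m m' : H} (h : IsConeProj C f m)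
    (h' : IsConeProj C f m') : m = m' := by
  have h1 := h.norm_sub_sq_le h'.mem
  have h2 := h'.norm_sub_sq_le h.mem
  rw [norm_sub_rev m m'] at h2
  have : ‖m' - m‖ ^ 2 ≤ 0 := by linarith
  have h3 : ‖m' - m‖ = 0 := pow_eq_zero_iff two_ne_zero |>.1 (le_antisymm this (sq_nonneg _))
  exact (sub_eq_zero.1 (norm_eq_zero.1 h3)).symm

theorem IsConeProj.norm_sub_le {C : Set H} {f f' m m' : H} (h : IsConeProj C f m)
    (h' : IsConeProj C f' m') : ‖m - m'‖ ≤ ‖f - f'‖ := by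
  have h1 := h.inner_le _ h'.mem
  have h2 := h'.inner_le _ h.mem
  have h3 : ‖m - m'‖ ^ 2 ≤ ⟪f - f', m - m'⟫ := by
    rw [norm_sub_sq_real, inner_sub_left, inner_sub_right, inner_sub_right, h.inner_self,
      h'.inner_self]
    rw [real_inner_comm m m'] at h2
    linarith
  have h4 := real_inner_le_norm (f - f') (m - m')
  rcases eq_or_lt_of_le (norm_nonneg (m - m')) with h0 | h0
  · rw [← h0]; exact norm_nonneg _
  · have : ‖m - m'‖ * ‖m - m'‖ ≤ ‖f - f'‖ * ‖m - m'‖ := by rw [← sq]; exact h3.trans h4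
    exact le_of_mul_le_mul_right this h0

/-- The projections `m l` of `l • q - g` onto a convex cone `C` of vectors orthogonal to `e` that
have pairwise nonnegative scalar products, where `q ∈ C`. -/
structure ConePath (C : Set H) (e q g : H) (m : ℝ → H) : Prop where
  cone : IsConvexCone C
  inner_nonneg : ∀ x ∈ C, ∀ y ∈ C, 0 ≤ ⟪x, y⟫
  orth : ∀ x ∈ C, ⟪e, x⟫ = 0
  orth_g : ⟪e, g⟫ = 0
  q_mem : q ∈ C
  q_ne : q ≠ 0
  proj : ∀ l, IsConeProj C (l • q - g) (m l)

/-- The cosine of the angle between two vectors. -/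
noncomputable def cosine (x y : H) : ℝ := ⟪x, y⟫ / (‖x‖ * ‖y‖)

theorem cosine_le_one (x y : H) : cosine x y ≤ 1 := by
  have := real_inner_le_norm x y
  exact div_le_one_of_le₀ this (by positivity)

theorem cosine_smul_right (x y : H) {t : ℝ} (ht : 0 < t) : cosine x (t • y) = cosine x y := by
  rw [cosine, cosine, inner_smul_right, norm_smul, Real.norm_of_nonneg ht.le,
    mul_left_comm, mul_div_mul_left _ _ ht.ne']

theorem cosine_mul {x y : H} (hx : x ≠ 0) (hy : y ≠ 0) : cosine x y * (‖x‖ * ‖y‖) = ⟪x, y⟫ :=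
  div_mul_cancel₀ _ (mul_ne_zero (norm_ne_zero_iff.2 hx) (norm_ne_zero_iff.2 hy))

theorem continuousAt_cosine {X : Type*} [TopologicalSpace X] {f : X → H} {x : H} {a : X}
    (hf : ContinuousAt f a) (hx : x ≠ 0) (ha : f a ≠ 0) :
    ContinuousAt (fun t => cosine x (f t)) a := by
  have h1 : ContinuousAt (fun t => ⟪x, f t⟫) a := Tendsto.inner tendsto_const_nhds hf
  exact h1.div (continuousAt_const.mul hf.norm)
    (mul_ne_zero (norm_ne_zero_iff.2 hx) (norm_ne_zero_iff.2 ha))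

namespace ConePath

variable {C : Set H} {e q g : H} {m : ℝ → H} (P : ConePath C e q g m)

include P

/-- The Lagrangian bound, with `l` as multiplier of the angle constraint: Moreau's inequality
followed by Cauchy–Schwarz. -/
theorem lower_bound (l : ℝ) {w : H} (hw : w ∈ C) :
    l * ⟪q, w⟫ - ‖m l‖ * ‖w‖ ≤ ⟪g, w⟫ := by
  have h1 := (P.proj l).inner_le w hw
  have h2 := real_inner_le_norm (m l) w
  rw [inner_sub_left, real_inner_smul_left] at h1
  linarith

theorem inner_m (l : ℝ) : ⟪g, m l⟫ = l * ⟪q, m l⟫ - ‖m l‖ ^ 2 := by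
  have h := (P.proj l).inner_self
  rw [inner_sub_left, real_inner_smul_left] at h
  linarith

/-- Attaining `lower_bound` forces equality in Cauchy–Schwarz, hence proportionality to `m l`. -/
theorem eq_smul_of_le {l : ℝ} (hl : m l ≠ 0) {w : H} (hw : w ∈ C)
    (h : ⟪g, w⟫ ≤ l * ⟪q, w⟫ - ‖m l‖ * ‖w‖) : w = (‖w‖ / ‖m l‖) • m l := by
  have h1 := (P.proj l).inner_le w hw
  have h2 := real_inner_le_norm (m l) w
  rw [inner_sub_left, real_inner_smul_left] at h1
  have h3 : ⟪m l, w⟫ = ‖m l‖ * ‖w‖ := by linarith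
  have h4 := (inner_eq_norm_mul_iff_real).1 h3
  rw [div_eq_inv_mul, mul_smul, h4, smul_smul, inv_mul_cancel₀ (norm_ne_zero_iff.2 hl), one_smul]

theorem norm_sub_le (l l' : ℝ) : ‖m l - m l'‖ ≤ |l - l'| * ‖q‖ := by
  refine ((P.proj l).norm_sub_le (P.proj l')).trans (le_of_eq ?_)
  rw [sub_sub_sub_cancel_right, ← sub_smul, norm_smul, Real.norm_eq_abs]

theorem continuous : Continuous m := by
  refine LipschitzWith.continuous (K := ‖q‖₊) (LipschitzWith.of_dist_le_mul fun l l' => ?_)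
  rw [dist_eq_norm, dist_eq_norm, Real.norm_eq_abs, mul_comm]
  exact P.norm_sub_le l l'

/-- As `q` has nonnegative scalar products with `C`, lowering `l` only decreases `⟪l • q - g, w⟫`;
if it was already nonpositive on all of `C`, then `0` stays the projection. -/
theorem eq_zero_of_le {l l' : ℝ} (hl : m l = 0) (h : l' ≤ l) : m l' = 0 := by
  refine ((P.proj l').unique ⟨P.cone.zero_mem, by simp, fun w hw => ?_⟩)
  have h1 := (P.proj l).inner_le w hw
  have h2 := P.inner_nonneg q P.q_mem w hw
  rw [hl] at h1
  rw [inner_zero_left, inner_sub_left, real_inner_smul_left] at h1 ⊢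
  nlinarith

/-- Optimality of the rescaled projection among the elements of the cone of the same norm. -/
theorem inner_le_of_norm_eq {l s : ℝ} (hl : m l ≠ 0) {w : H} (hw : w ∈ C)
    (hws : ‖w‖ = s) (hc : l * (cosine q (m l) * (‖q‖ * s)) ≤ l * ⟪q, w⟫) :
    ⟪g, (s / ‖m l‖) • m l⟫ ≤ ⟪g, w⟫ ∧ (⟪g, w⟫ ≤ ⟪g, (s / ‖m l‖) • m l⟫ →
      w = (s / ‖m l‖) • m l) := by
  have hn : ‖m l‖ ≠ 0 := norm_ne_zero_iff.2 hl
  have h1 : ⟪g, (s / ‖m l‖) • m l⟫ = l * (cosine q (m l) * (‖q‖ * s)) - ‖m l‖ * s := by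
    have h2 : ⟪q, m l⟫ = cosine q (m l) * (‖q‖ * ‖m l‖) := (cosine_mul P.q_ne hl).symm
    rw [inner_smul_right, P.inner_m, h2]
    field_simp
  have h3 := P.lower_bound l hw
  rw [hws] at h3
  refine ⟨by linarith, fun h => ?_⟩
  rw [← hws]
  refine P.eq_smul_of_le hl hw ?_
  rw [hws]
  linarith

theorem inner_smul_m (l s : ℝ) (hl : m l ≠ 0) :
    ⟪g, (s / ‖m l‖) • m l⟫ = s * (l * (cosine q (m l) * ‖q‖) - ‖m l‖) := by
  have hn : ‖m l‖ ≠ 0 := norm_ne_zero_iff.2 hl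
  have h2 : ⟪q, m l⟫ = cosine q (m l) * (‖q‖ * ‖m l‖) := (cosine_mul P.q_ne hl).symm
  rw [inner_smul_right, P.inner_m, h2]
  field_simp

omit P in
theorem norm_unit {l : ℝ} (hl : m l ≠ 0) : ‖(1 / ‖m l‖) • m l‖ = 1 := by
  rw [norm_smul, norm_div, norm_one, norm_norm, one_div, inv_mul_cancel₀ (norm_ne_zero_iff.2 hl)]

theorem unit_mem (l : ℝ) : (1 / ‖m l‖) • m l ∈ C :=
  P.cone.smul_mem _ (P.proj l).mem _ (by positivity)

theorem inner_q_unit {l : ℝ} (hl : m l ≠ 0) :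
    ⟪q, (1 / ‖m l‖) • m l⟫ = cosine q (m l) * ‖q‖ := by
  rw [inner_smul_right, ← cosine_mul P.q_ne hl]
  have hn : ‖m l‖ ≠ 0 := norm_ne_zero_iff.2 hl
  field_simp

/-- The support inequality of the value function at the parameter `l`. -/
theorem support {l l' : ℝ} (hl : m l ≠ 0) (hl' : m l' ≠ 0) :
    ⟪g, (1 / ‖m l‖) • m l⟫ + l * ‖q‖ * (cosine q (m l') - cosine q (m l))
      ≤ ⟪g, (1 / ‖m l'‖) • m l'⟫ := by
  have h := P.lower_bound l (P.unit_mem l')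
  rw [P.inner_q_unit hl', norm_unit hl'] at h
  rw [P.inner_smul_m l 1 hl]
  linarith

/-- Adding the two support inequalities, with `l` and `l'` exchanged, cancels the values and leaves
a product of the two increments. -/
theorem cosine_mono {l l' : ℝ} (hl : m l ≠ 0) (hl' : m l' ≠ 0) (h : l < l') :
    cosine q (m l) ≤ cosine q (m l') := by
  have h1 := P.support hl hl'
  have h2 := P.support hl' hl
  have hq : 0 < ‖q‖ := norm_pos_iff.2 P.q_ne
  have h3 : 0 ≤ (l' - l) * ‖q‖ * (cosine q (m l') - cosine q (m l)) := by linarith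
  have h4 : 0 < (l' - l) * ‖q‖ := mul_pos (sub_pos.2 h) hq
  have := nonneg_of_mul_nonneg_right h3 h4
  linarith

/-- For `l ≥ 0` the vector `l • q` lies in `C` and is its own projection; projections do not
increase distances. -/
theorem norm_sub_smul_le {l : ℝ} (hl : 0 ≤ l) : ‖m l - l • q‖ ≤ ‖g‖ := by
  have hq : IsConeProj C (l • q) (l • q) :=
    ⟨P.cone.smul_mem _ P.q_mem _ hl, real_inner_self_eq_norm_sq _, fun _ _ => le_rfl⟩
  refine ((P.proj l).norm_sub_le hq).trans (le_of_eq ?_)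
  rw [sub_sub_cancel_left, norm_neg]

theorem tendsto_cosine_atTop : Tendsto (fun l => cosine q (m l)) atTop (𝓝 1) := by
  have hq : 0 < ‖q‖ := norm_pos_iff.2 P.q_ne
  have h1 : Tendsto (fun l : ℝ => (1 / l) • m l) atTop (𝓝 q) := by
    rw [tendsto_iff_norm_sub_tendsto_zero]
    have h2 : Tendsto (fun l : ℝ => ‖g‖ * l⁻¹) atTop (𝓝 0) := by
      simpa using tendsto_inv_atTop_zero.const_mul ‖g‖
    refine squeeze_zero' (Eventually.of_forall fun _ => norm_nonneg _) ?_ h2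
    filter_upwards [eventually_gt_atTop 0] with l hl
    have h3 : (1 / l) • m l - q = l⁻¹ • (m l - l • q) := by
      rw [smul_sub, smul_smul, inv_mul_cancel₀ hl.ne', one_smul, one_div]
    rw [h3, norm_smul, Real.norm_of_nonneg (inv_nonneg.2 hl.le), mul_comm]
    exact mul_le_mul_of_nonneg_right (P.norm_sub_smul_le hl.le) (inv_nonneg.2 hl.le)
  have h4 : Tendsto (fun y => cosine q y) (𝓝 q) (𝓝 (cosine q q)) :=
    continuousAt_cosine continuousAt_id P.q_ne P.q_ne
  have h5 : cosine q q = 1 := by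
    rw [cosine, real_inner_self_eq_norm_mul_norm, div_self (by positivity)]
  rw [h5] at h4
  refine (h4.comp h1).congr' ?_
  filter_upwards [eventually_gt_atTop 0] with l hl
  exact cosine_smul_right _ _ (by positivity)

theorem continuousAt_cosine_m {l : ℝ} (hl : m l ≠ 0) :
    ContinuousAt (fun l => cosine q (m l)) l :=
  continuousAt_cosine P.continuous.continuousAt P.q_ne hl

theorem cosine_nonneg (l : ℝ) : 0 ≤ cosine q (m l) :=
  div_nonneg (P.inner_nonneg _ P.q_mem _ (P.proj l).mem) (by positivity)

omit P in
/-- The infimum of the cosines along the path. -/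
noncomputable def startCosine (q : H) (m : ℝ → H) : ℝ :=
  sInf ((fun l => cosine q (m l)) '' Ioi 0)

theorem bddBelow_cosine : BddBelow ((fun l => cosine q (m l)) '' Ioi 0) :=
  ⟨0, by rintro _ ⟨l, -, rfl⟩; exact P.cosine_nonneg l⟩

theorem tendsto_startCosine (hpos : ∀ l, 0 < l → m l ≠ 0) :
    Tendsto (fun l => cosine q (m l)) (𝓝[>] 0) (𝓝 (startCosine q m)) := by
  refine MonotoneOn.tendsto_nhdsGT (fun l hl l' hl' h => ?_) P.bddBelow_cosine
  rcases eq_or_lt_of_le h with rfl | h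
  · exact le_rfl
  · exact P.cosine_mono (hpos l hl) (hpos l' hl') h

theorem startCosine_le {l : ℝ} (hl : 0 < l) : startCosine q m ≤ cosine q (m l) :=
  csInf_le P.bddBelow_cosine ⟨l, hl, rfl⟩

theorem cosine_zero_eq (hpos : ∀ l, 0 < l → m l ≠ 0) (h0 : m 0 ≠ 0) :
    cosine q (m 0) = startCosine q m :=
  tendsto_nhds_unique ((P.continuousAt_cosine_m h0).mono_left nhdsWithin_le_nhds)
    (P.tendsto_startCosine hpos)

omit P in
/-- Residuals of projections along a ray that stay orthogonal to `h` while moving in the direction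
of `q - α • h` force this direction into the dual cone. -/
def HasPlateauProperty (C : Set H) (e q : H) : Prop :=
  ∀ h ∈ C, ∀ (r₁ r₂ : H) (α δ : ℝ), 0 < δ → ⟪e, r₁⟫ = 0 → ⟪e, r₂⟫ = 0 →
    (∀ w ∈ C, ⟪r₁, w⟫ ≤ 0) → (∀ w ∈ C, ⟪r₂, w⟫ ≤ 0) → ⟪r₁, h⟫ = 0 → ⟪r₂, h⟫ = 0 →
    r₂ - r₁ = δ • (q - α • h) → ∀ w ∈ C, 0 ≤ ⟪q - α • h, w⟫

/-- Both unit vectors are feasible for the same angle, the one at `l` is the unique minimiser, and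
the support inequality at `l'` says that the other is no worse. -/
theorem unit_eq_of_cosine_eq {l l' : ℝ} (hl : m l ≠ 0) (hl' : m l' ≠ 0)
    (h : cosine q (m l) = cosine q (m l')) : (1 / ‖m l'‖) • m l' = (1 / ‖m l‖) • m l := by
  refine (P.inner_le_of_norm_eq hl (P.unit_mem l') (norm_unit hl') ?_).2 ?_
  · rw [P.inner_q_unit hl', h, mul_one]
  · have := P.support hl' hl
    rw [h, sub_self, mul_zero, add_zero] at this
    exact this

theorem residual (l : ℝ) :
    (∀ w ∈ C, ⟪l • q - g - m l, w⟫ ≤ 0) ∧ ⟪e, l • q - g - m l⟫ = 0 := by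
  constructor
  · intro w hw
    have := (P.proj l).inner_le w hw
    rw [inner_sub_left]; linarith
  · rw [inner_sub_right, inner_sub_right, inner_smul_right, P.orth _ P.q_mem, P.orth_g,
      P.orth _ (P.proj l).mem]
    simp

/-- A plateau of the cosine propagates to the left. With `x` the common direction, the plateau
property makes `q - α • x` nonnegative on `C`; subtracting a positive multiple of it from the
residual at `l₁` keeps the residual polar and orthogonal to `x`, so the projection merely shrinks
along `x`. -/
theorem cosine_eq_of_lt (hpl : HasPlateauProperty C e q) (hpos : ∀ l, 0 < l → m l ≠ 0)
    {l₀ l₁ l₂ : ℝ} (h0 : 0 < l₀) (h01 : l₀ < l₁) (h12 : l₁ < l₂)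
    (h : cosine q (m l₁) = cosine q (m l₂)) : cosine q (m l₀) = cosine q (m l₁) := by
  have hl1 := hpos l₁ (h0.trans h01)
  have hl2 := hpos l₂ (h0.trans (h01.trans h12))
  have hu := P.unit_eq_of_cosine_eq hl1 hl2 h
  set x := (1 / ‖m l₁‖) • m l₁ with hx
  set b₁ := ‖m l₁‖ with hb1
  set b₂ := ‖m l₂‖ with hb2
  have hb1p : 0 < b₁ := norm_pos_iff.2 hl1
  have hb2p : 0 < b₂ := norm_pos_iff.2 hl2
  have hm1 : m l₁ = b₁ • x := by rw [hx, smul_smul, mul_one_div_cancel hb1p.ne', one_smul]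
  have hm2 : m l₂ = b₂ • x := by rw [← hu, smul_smul, mul_one_div_cancel hb2p.ne', one_smul]
  have hxC : x ∈ C := P.unit_mem l₁
  have hδ : 0 < l₂ - l₁ := sub_pos.2 h12
  obtain ⟨p1, e1⟩ := P.residual l₁
  obtain ⟨p2, e2⟩ := P.residual l₂
  have o1 : ⟪l₁ • q - g - m l₁, x⟫ = 0 := by
    rw [hx, inner_smul_right, inner_sub_left, (P.proj l₁).inner_self, real_inner_self_eq_norm_sq]
    simp
  have o2 : ⟪l₂ • q - g - m l₂, x⟫ = 0 := by
    rw [← hu, inner_smul_right, inner_sub_left, (P.proj l₂).inner_self,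
      real_inner_self_eq_norm_sq]
    simp
  -- The rate at which the norm of the projection grows along the ray of `x`.
  set α := (b₂ - b₁) / (l₂ - l₁) with hα
  have hd : (l₂ • q - g - m l₂) - (l₁ • q - g - m l₁) = (l₂ - l₁) • (q - α • x) := by
    rw [smul_sub, smul_smul, hα, mul_div_cancel₀ _ hδ.ne', hm1, hm2, sub_smul, sub_smul]
    abel
  clear_value x b₁ b₂ α
  have key := hpl x hxC _ _ α _ hδ e1 e2 p1 p2 o1 o2 hd
  have hdx : ⟪q - α • x, x⟫ = 0 := by
    have : (l₂ - l₁) * ⟪q - α • x, x⟫ = 0 := by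
      rw [← real_inner_smul_left, ← hd, inner_sub_left, o1, o2, sub_zero]
    exact (mul_eq_zero.1 this).resolve_left hδ.ne'
  have step : ∀ l, l < l₁ → 0 ≤ b₁ - (l₁ - l) * α → m l = (b₁ - (l₁ - l) * α) • x := by
    intro l hl hβ
    have hr : l • q - g - (b₁ - (l₁ - l) * α) • x
        = (l₁ • q - g - m l₁) - (l₁ - l) • (q - α • x) := by
      rw [hm1]
      module
    refine (P.proj l).unique (IsConeProj.of_orthogonal (P.cone.smul_mem _ hxC _ hβ) ?_ ?_)
    · rw [hr, inner_smul_right, inner_sub_left, o1, real_inner_smul_left, hdx]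
      simp
    · intro w hw
      rw [hr, inner_sub_left, real_inner_smul_left]
      have := p1 w hw
      have := mul_nonneg (sub_nonneg.2 hl.le) (key w hw)
      linarith
  rcases lt_or_ge 0 (b₁ - (l₁ - l₀) * α) with hβ | hβ
  · rw [step l₀ h01 hβ.le, hm1, cosine_smul_right _ _ hβ, cosine_smul_right _ _ hb1p]
  -- If the linear formula for the norm reached zero at or above `l₀`, the projection would vanish
  -- at the positive parameter `l₁ - b₁ / α`.
  · exfalso
    have hαp : 0 < α := by
      by_contra hn
      have := mul_nonpos_of_nonneg_of_nonpos (sub_nonneg.2 h01.le) (not_lt.1 hn)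
      linarith
    have hle : b₁ / α ≤ l₁ - l₀ := by rw [div_le_iff₀ hαp]; linarith
    have hz : b₁ - (l₁ - (l₁ - b₁ / α)) * α = 0 := by
      rw [sub_sub_cancel, div_mul_cancel₀ _ hαp.ne', sub_self]
    have hlt : l₁ - b₁ / α < l₁ := by have := div_pos hb1p hαp; linarith
    have := step _ hlt hz.ge
    rw [hz, zero_smul] at this
    exact hpos _ (by linarith) this

theorem exists_unique_cosine_eq (hpl : HasPlateauProperty C e q) (hpos : ∀ l, 0 < l → m l ≠ 0)
    {K : ℝ} (hK0 : startCosine q m < K) (hK1 : K < 1) :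
    ∃ l, 0 < l ∧ cosine q (m l) = K ∧ ∀ l', 0 < l' → cosine q (m l') = K → l' = l := by
  obtain ⟨_, ⟨l₀, hl0, rfl⟩, hlt⟩ := exists_lt_of_csInf_lt (nonempty_Ioi.image _) hK0
  obtain ⟨l₁, hl1K, hl1⟩ := ((P.tendsto_cosine_atTop.eventually (lt_mem_nhds hK1)).and
    (eventually_gt_atTop 0)).exists
  have hc : ContinuousOn (fun l => cosine q (m l)) (Ioi 0) := fun l hl =>
    (P.continuousAt_cosine_m (hpos l hl)).continuousWithinAt
  obtain ⟨l, hl, hlK⟩ := isPreconnected_Ioi.intermediate_value hl0 hl1 hc ⟨hlt.le, hl1K.le⟩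
  -- Since `K` exceeds the infimum of the cosines, some `l₀` has a cosine below `K`; a plateau at
  -- level `K` would extend left to `l₀`.
  have huniq : ∀ a b, 0 < a → a < b → cosine q (m a) = K → cosine q (m b) = K → False := by
    intro a b ha hab haK hbK
    have h0a : l₀ < a := by
      by_contra hn
      rcases eq_or_lt_of_le (not_lt.1 hn) with h | h
      · rw [← h] at hlt; exact absurd haK hlt.ne
      · have := P.cosine_mono (hpos a ha) (hpos l₀ hl0) h
        exact absurd hlt (not_lt.2 (haK ▸ this))
    have := P.cosine_eq_of_lt hpl hpos hl0 h0a hab (haK.trans hbK.symm)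
    exact hlt.ne (this.trans haK)
  refine ⟨l, hl, hlK, fun l' hl' hl'K => ?_⟩
  rcases lt_trichotomy l' l with h | h | h
  · exact (huniq l' l hl' h hl'K hlK).elim
  · exact h
  · exact (huniq l l' hl h hlK hl'K).elim

/-- The value function is locally Lipschitz in the prescribed cosine. -/
theorem continuousOn_value (hpos : ∀ l, 0 < l → m l ≠ 0) {lam : ℝ → ℝ}
    (hlam : ∀ K ∈ Ioo (startCosine q m) 1, 0 < lam K ∧ cosine q (m (lam K)) = K) :
    ContinuousOn (fun K => ⟪g, (1 / ‖m (lam K)‖) • m (lam K)⟫) (Ioo (startCosine q m) 1) := by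
  intro K hK
  refine ContinuousAt.continuousWithinAt ?_
  -- Multipliers increase with the cosine, so the one at `K₁ > K` bounds all slopes near `K` and
  -- provides the Lipschitz constant.
  set K₁ := (K + 1) / 2 with hK1
  have hKK1 : K < K₁ := by rw [hK1]; linarith [hK.2]
  have hK1mem : K₁ ∈ Ioo (startCosine q m) 1 := ⟨hK.1.trans hKK1, by rw [hK1]; linarith [hK.2]⟩
  obtain ⟨hL, hLc⟩ := hlam K₁ hK1mem
  have hle : ∀ K', K' ∈ Ioo (startCosine q m) 1 → K' < K₁ → lam K' ≤ lam K₁ := by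
    intro K' hK' hlt
    by_contra hn
    obtain ⟨h1, h2⟩ := hlam K' hK'
    have := P.cosine_mono (hpos _ hL) (hpos _ h1) (not_le.1 hn)
    linarith
  set r := min (K - startCosine q m) (K₁ - K) with hr
  have hrpos : 0 < r := lt_min (sub_pos.2 hK.1) (sub_pos.2 hKK1)
  refine continuousAt_of_locally_lipschitz hrpos (lam K₁ * ‖q‖) fun K' hK' => ?_
  rw [Real.dist_eq] at hK'
  have hab := abs_lt.1 hK'
  have hr1 : r ≤ K - startCosine q m := min_le_left _ _
  have hr2 : r ≤ K₁ - K := min_le_right _ _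
  have hK'1 : K' < K₁ := by linarith [hab.2]
  have hmem : K' ∈ Ioo (startCosine q m) 1 := ⟨by linarith [hab.1], hK'1.trans hK1mem.2⟩
  obtain ⟨p, c⟩ := hlam K hK
  obtain ⟨p', c'⟩ := hlam K' hmem
  have s1 := P.support (hpos _ p) (hpos _ p')
  have s2 := P.support (hpos _ p') (hpos _ p)
  rw [c, c'] at s1 s2
  have hb : ∀ a t : ℝ, 0 < a → a ≤ lam K₁ → a * ‖q‖ * t ≤ lam K₁ * ‖q‖ * |t| := by
    intro a t ha hal
    calc a * ‖q‖ * t ≤ a * ‖q‖ * |t| := by gcongr; exact le_abs_self t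
      _ ≤ lam K₁ * ‖q‖ * |t| := by gcongr
  have b1 := hb (lam K) (-(K' - K)) p (hle K hK hKK1)
  have b2 := hb (lam K') (K' - K) p' (hle K' hmem hK'1)
  rw [abs_neg] at b1
  rw [Real.dist_eq, Real.dist_eq, abs_le]
  constructor <;> linarith

/-- The value equals `l` times a convergent factor minus `‖m l‖`; both terms vanish in the limit. -/
theorem tendsto_inner_unit (hpos : ∀ l, 0 < l → m l ≠ 0) (h0 : m 0 = 0) :
    Tendsto (fun l => ⟪g, (1 / ‖m l‖) • m l⟫) (𝓝[>] 0) (𝓝 0) := by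
  have h1 : Tendsto (fun l : ℝ => l) (𝓝[>] 0) (𝓝 0) := tendsto_id.mono_left nhdsWithin_le_nhds
  have h2 : Tendsto (fun l => ‖m l‖) (𝓝[>] 0) (𝓝 ‖m 0‖) :=
    (P.continuous.norm.tendsto 0).mono_left nhdsWithin_le_nhds
  have h3 := (h1.mul ((P.tendsto_startCosine hpos).mul_const ‖q‖)).sub h2
  rw [h0, norm_zero, zero_mul, sub_zero] at h3
  refine h3.congr' ?_
  filter_upwards [self_mem_nhdsWithin] with l hl
  rw [P.inner_smul_m l 1 (hpos l hl), one_mul]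

theorem inner_g_nonneg (h0 : m 0 = 0) {w : H} (hw : w ∈ C) : 0 ≤ ⟪g, w⟫ := by
  have := P.lower_bound 0 hw
  rw [h0] at this
  simpa using this

/-- If the path starts at `0` and the face of `C` orthogonal to `g` is not orthogonal to `q`, then
the directions along the path converge to a direction in this face. -/
theorem exists_limit_direction [CompleteSpace H] (hcl : IsClosed C)
    (hpos : ∀ l, 0 < l → m l ≠ 0) (h0 : m 0 = 0)
    {w : H} (hw : w ∈ C) (hgw : ⟪g, w⟫ = 0) (hqw : 0 < ⟪q, w⟫) :
    ∃ v ∈ C, v ≠ 0 ∧ ⟪g, v⟫ = 0 ∧ cosine q v = startCosine q m := by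
  set n : ℝ → H := fun l => (1 / l) • m l with hn
  have hnC : ∀ l, 0 < l → n l ∈ C := fun l hl =>
    P.cone.smul_mem _ (P.proj l).mem _ (by positivity)
  have hself : ∀ l, 0 < l → ⟪q, n l⟫ - (1 / l) * ⟪g, n l⟫ = ‖n l‖ ^ 2 := by
    intro l hl
    simp only [hn, inner_smul_right, P.inner_m, norm_smul]
    rw [Real.norm_of_nonneg (by positivity)]
    field_simp
    ring
  have hle : ∀ l, 0 < l → ∀ y ∈ C, ⟪q, y⟫ - (1 / l) * ⟪g, y⟫ ≤ ⟪n l, y⟫ := by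
    intro l hl y hy
    have h1 := (P.proj l).inner_le y hy
    rw [inner_sub_left, real_inner_smul_left] at h1
    have h2 := mul_le_mul_of_nonneg_left h1 (by positivity : 0 ≤ 1 / l)
    simp only [hn, real_inner_smul_left]
    have h3 : 1 / l * (l * ⟪q, y⟫ - ⟪g, y⟫) = ⟪q, y⟫ - 1 / l * ⟪g, y⟫ := by field_simp
    linarith
  -- The squared norms decrease as `l` decreases and are bounded below, so this estimate makes the
  -- sequence Cauchy.
  have hdiff : ∀ l l', 0 < l → l ≤ l' → ‖n l - n l'‖ ^ 2 ≤ ‖n l'‖ ^ 2 - ‖n l‖ ^ 2 := by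
    intro l l' hl hll'
    have h1 := hle l' (hl.trans_le hll') (n l) (hnC l hl)
    have h2 := hself l hl
    have h3 : (1 / l') * ⟪g, n l⟫ ≤ (1 / l) * ⟪g, n l⟫ :=
      mul_le_mul_of_nonneg_right (one_div_le_one_div_of_le hl hll')
        (P.inner_g_nonneg h0 (hnC l hl))
    rw [norm_sub_sq_real, real_inner_comm]
    linarith
  set a : ℕ → ℝ := fun k => 1 / ((k : ℝ) + 1) with ha
  have hapos : ∀ k, 0 < a k := fun k => by simp only [ha]; positivity
  have hanti : Antitone a := fun i j hij => by
    simp only [ha]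
    exact one_div_le_one_div_of_le (by positivity) (by exact_mod_cast Nat.succ_le_succ hij)
  have hN : Antitone fun k => ‖n (a k)‖ ^ 2 := fun i j hij => by
    have := hdiff (a j) (a i) (hapos j) (hanti hij)
    have := sq_nonneg ‖n (a j) - n (a i)‖
    simp only
    linarith
  have hNc : CauchySeq fun k => ‖n (a k)‖ ^ 2 :=
    (tendsto_atTop_ciInf hN ⟨0, by rintro _ ⟨k, rfl⟩; positivity⟩).cauchySeq
  have hC : CauchySeq fun k => n (a k) := by
    rw [Metric.cauchySeq_iff'] at hNc ⊢
    intro ε hε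
    obtain ⟨N, hNN⟩ := hNc (ε ^ 2) (by positivity)
    refine ⟨N, fun k hk => ?_⟩
    have h1 := hNN k hk
    have h2 := hdiff (a k) (a N) (hapos k) (hanti hk)
    rw [Real.dist_eq] at h1
    have h3 := (abs_lt.1 h1).1
    rw [dist_eq_norm]
    exact lt_of_pow_lt_pow_left₀ 2 hε.le (by linarith)
  obtain ⟨v, hv⟩ := cauchySeq_tendsto_of_complete hC
  have ha0 : Tendsto a atTop (𝓝 0) := tendsto_one_div_add_atTop_nhds_zero_nat
  have ha0' : Tendsto a atTop (𝓝[>] 0) :=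
    tendsto_nhdsWithin_iff.2 ⟨ha0, Eventually.of_forall hapos⟩
  -- The penalty does not act on `w`, which is what keeps the limit away from zero.
  have hqv : ⟪q, w⟫ ≤ ⟪v, w⟫ := by
    refine ge_of_tendsto (hv.inner tendsto_const_nhds) (Eventually.of_forall fun k => ?_)
    have := hle (a k) (hapos k) w hw
    rwa [hgw, mul_zero, sub_zero] at this
  have hv0 : v ≠ 0 := by
    rintro rfl
    rw [inner_zero_left] at hqv
    linarith
  refine ⟨v, hcl.mem_of_tendsto hv (Eventually.of_forall fun k => hnC _ (hapos k)), hv0, ?_, ?_⟩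
  · have h1 : Tendsto (fun k => ⟪g, n (a k)⟫) atTop (𝓝 ⟪g, v⟫) := tendsto_const_nhds.inner hv
    have h2 : Tendsto (fun k => a k * (⟪q, n (a k)⟫ - ‖n (a k)‖ ^ 2)) atTop
        (𝓝 (0 * (⟪q, v⟫ - ‖v‖ ^ 2))) :=
      ha0.mul ((tendsto_const_nhds.inner hv).sub (hv.norm.pow 2))
    rw [zero_mul] at h2
    refine tendsto_nhds_unique h1 (h2.congr fun k => ?_)
    rw [← hself (a k) (hapos k), sub_sub_cancel, ← mul_assoc, mul_one_div_cancel (hapos k).ne',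
      one_mul]
  · have h1 : Tendsto (fun k => cosine q (n (a k))) atTop (𝓝 (cosine q v)) :=
      (continuousAt_cosine continuousAt_id P.q_ne hv0).tendsto.comp hv
    refine tendsto_nhds_unique h1 (((P.tendsto_startCosine hpos).comp ha0').congr fun k => ?_)
    exact (cosine_smul_right _ _ (one_div_pos.2 (hapos k))).symm

end ConePath

end Cone

theorem exists_mem_Ioo_of_ae {p : ℝ → Prop} (h : ∀ᵐ u ∂unif, p u) {a b : ℝ} (ha : 0 ≤ a)
    (hab : a < b) (hb : b ≤ 1) : ∃ u ∈ Ioo a b, p u := by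
  have h' : ∀ᵐ u ∂(volume.restrict (Ioo a b)), p u :=
    ae_mono (Measure.restrict_mono (Ioo_subset_Ioo ha hb) le_rfl) h
  have hne : NeBot (ae (volume.restrict (Ioo a b))) := by
    rw [ae_neBot, Ne, Measure.restrict_eq_zero, Real.volume_Ioo]
    simpa using hab
  exact ((ae_restrict_mem measurableSet_Ioo).and h').exists

/-! ### Scalar products with truncations of a monotone function -/

/-- A truncation of `h` and its complement in `h` are both non-decreasing. Each pairs nonpositively
with `r`, and the two pairings add up to zero. -/
theorem integral_mul_max_sub_eq_zero {r h : ℝ → ℝ} (hr : MemLp r 2 unif) (hh : MemLp h 2 unif)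
    (hmono : MonotoneOn h (Ioo 0 1))
    (hpolar : ∀ w, MemLp w 2 unif → MonotoneOn w (Ioo 0 1) → ∫ u, r u * w u ∂unif ≤ 0)
    (horth : ∫ u, r u * h u ∂unif = 0) (v : ℝ) : ∫ u, r u * max (h u - v) 0 ∂unif = 0 := by
  have hp : MemLp (fun u => max (h u - v) 0) 2 unif := (hh.sub (memLp_const v)).pos_part
  have hm : MemLp (fun u => h u - max (h u - v) 0) 2 unif := hh.sub hp
  have h1 := hpolar _ hp fun x hx y hy hxy => by
    have := hmono hx hy hxy
    exact max_le_max (by linarith) le_rfl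
  have h2 := hpolar _ hm fun x hx y hy hxy => by
    have := hmono hx hy hxy
    rcases max_cases (h x - v) 0 with ⟨h1, _⟩ | ⟨h1, _⟩ <;>
    rcases max_cases (h y - v) 0 with ⟨h2, _⟩ | ⟨h2, _⟩ <;> linarith
  have h3 : ∫ u, r u * (h u - max (h u - v) 0) ∂unif
      = ∫ u, r u * h u ∂unif - ∫ u, r u * max (h u - v) 0 ∂unif := by
    rw [← integral_sub (f := fun u => r u * h u) (g := fun u => r u * max (h u - v) 0)
      (hr.integrable_mul hh) (hr.integrable_mul hp)]
    simp_rw [mul_sub]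
  linarith

theorem integral_mul_eq_zero_of_tendsto {r : ℝ → ℝ} (hr : Integrable r unif) {φ : ℕ → ℝ → ℝ}
    {ψ : ℝ → ℝ} (hφm : ∀ n, AEMeasurable (φ n) unif) (hφ : ∀ n u, |φ n u| ≤ 1)
    (h0 : ∀ n, ∫ u, r u * φ n u ∂unif = 0)
    (hlim : ∀ u, Tendsto (fun n => φ n u) atTop (𝓝 (ψ u))) : ∫ u, r u * ψ u ∂unif = 0 := by
  have h := tendsto_integral_of_dominated_convergence (μ := unif) (F := fun n u => r u * φ n u)
    (f := fun u => r u * ψ u) (fun u => ‖r u‖)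
    (fun n => (hr.1.aemeasurable.mul (hφm n)).aestronglyMeasurable) hr.norm
    (fun n => Eventually.of_forall fun u => by
      rw [norm_mul]
      exact mul_le_of_le_one_right (norm_nonneg _) (hφ n u))
    (Eventually.of_forall fun u => (hlim u).const_mul (r u))
  simp_rw [h0] at h
  exact (tendsto_nhds_unique h tendsto_const_nhds)

theorem integral_mul_indicator (r : ℝ → ℝ) (s : Set ℝ) :
    ∫ u, r u * s.indicator (fun _ => (1 : ℝ)) u ∂unif = ∫ u, s.indicator r u ∂unif := by
  congr 1; ext u
  by_cases hu : u ∈ s <;> simp [hu]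

/-- Indicators of superlevel sets are bounded pointwise limits of difference quotients of the
truncations in `v`: quotients to the right of `v` give the strict set, quotients to the left the
non-strict one. -/
theorem integral_superlevel_eq_zero {r h : ℝ → ℝ} (hr : MemLp r 2 unif) (hh : MemLp h 2 unif)
    (hz : ∀ v, ∫ u, r u * max (h u - v) 0 ∂unif = 0) (v : ℝ) :
    ∫ u, {u | v < h u}.indicator r u ∂unif = 0 ∧ ∫ u, {u | v ≤ h u}.indicator r u ∂unif = 0 := by
  have hi := MemLp.integrable_unif hr
  have hm : ∀ v, AEMeasurable (fun u => max (h u - v) 0) unif := fun v =>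
    (hh.1.aemeasurable.sub_const v).max aemeasurable_const
  have hint : ∀ v, Integrable (fun u => r u * max (h u - v) 0) unif := fun v =>
    hr.integrable_mul (hh.sub (memLp_const v)).pos_part
  have hdiff : ∀ v v' t : ℝ, ∫ u, r u * (t * (max (h u - v) 0 - max (h u - v') 0)) ∂unif = 0 := by
    intro v v' t
    have : ∀ u, r u * (t * (max (h u - v) 0 - max (h u - v') 0))
        = t * (r u * max (h u - v) 0 - r u * max (h u - v') 0) := fun u => by ring
    simp_rw [this]
    rw [integral_const_mul, integral_sub (hint v) (hint v'), hz, hz]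
    simp
  have hinv : ∀ n : ℕ, ((n : ℝ) + 1) * (1 / ((n : ℝ) + 1)) = 1 := fun n => by field_simp
  have hbd : ∀ (z : ℝ) (n : ℕ),
      |((n : ℝ) + 1) * (max z 0 - max (z - 1 / ((n : ℝ) + 1)) 0)| ≤ 1 := by
    intro z n
    have hn : (0 : ℝ) < (n : ℝ) + 1 := by positivity
    have hn' : (0 : ℝ) < 1 / ((n : ℝ) + 1) := by positivity
    rw [abs_mul, abs_of_pos hn]
    refine (mul_le_mul_of_nonneg_left ?_ hn.le).trans (hinv n).le
    have h1 := abs_max_sub_max_le_abs z (z - 1 / ((n : ℝ) + 1)) 0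
    rwa [sub_sub_cancel, abs_of_pos hn'] at h1
  have hev : ∀ z : ℝ, 0 < z → ∀ᶠ n : ℕ in atTop, 1 / ((n : ℝ) + 1) < z := fun z hz =>
    tendsto_one_div_add_atTop_nhds_zero_nat.eventually (gt_mem_nhds hz)
  constructor
  · rw [← integral_mul_indicator]
    refine integral_mul_eq_zero_of_tendsto hi
      (φ := fun n u => ((n : ℝ) + 1) * (max (h u - v) 0 - max (h u - (v + 1 / ((n : ℝ) + 1))) 0))
      (fun n => ((hm _).sub (hm _)).const_mul _) (fun n u => ?_) (fun n => hdiff _ _ _)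
      (fun u => ?_)
    · rw [← sub_sub]; exact hbd _ n
    · by_cases hu : v < h u
      · rw [indicator_of_mem (show u ∈ {u | v < h u} from hu)]
        refine tendsto_const_nhds.congr' ?_
        filter_upwards [hev _ (sub_pos.2 hu)] with n hn
        rw [max_eq_left (by linarith), max_eq_left (by linarith)]
        rw [show h u - v - (h u - (v + 1 / ((n : ℝ) + 1))) = 1 / ((n : ℝ) + 1) by ring, hinv]
      · rw [indicator_of_notMem (fun h' : u ∈ {u | v < h u} => hu h')]
        refine tendsto_const_nhds.congr fun n => ?_
        have hn' : (0 : ℝ) < 1 / ((n : ℝ) + 1) := by positivity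
        have := not_lt.1 hu
        rw [max_eq_right (by linarith), max_eq_right (by linarith)]
        simp
  · rw [← integral_mul_indicator]
    refine integral_mul_eq_zero_of_tendsto hi
      (φ := fun n u => ((n : ℝ) + 1) * (max (h u - (v - 1 / ((n : ℝ) + 1))) 0 - max (h u - v) 0))
      (fun n => ((hm _).sub (hm _)).const_mul _) (fun n u => ?_) (fun n => hdiff _ _ _)
      (fun u => ?_)
    · have := hbd (h u - (v - 1 / ((n : ℝ) + 1))) n
      rwa [show h u - (v - 1 / ((n : ℝ) + 1)) - 1 / ((n : ℝ) + 1) = h u - v by ring] at this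
    · by_cases hu : v ≤ h u
      · rw [indicator_of_mem (show u ∈ {u | v ≤ h u} from hu)]
        refine tendsto_const_nhds.congr fun n => ?_
        have hn' : (0 : ℝ) < 1 / ((n : ℝ) + 1) := by positivity
        rw [max_eq_left (by linarith), max_eq_left (by linarith)]
        rw [show h u - (v - 1 / ((n : ℝ) + 1)) - (h u - v) = 1 / ((n : ℝ) + 1) by ring, hinv]
      · rw [indicator_of_notMem (fun h' : u ∈ {u | v ≤ h u} => hu h')]
        refine tendsto_const_nhds.congr' ?_
        have hu' := not_le.1 hu
        filter_upwards [hev _ (sub_pos.2 hu')] with n hn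
        rw [max_eq_right (by linarith), max_eq_right (by linarith)]
        simp

/-- If `q - α h` integrates to zero over the superlevel sets of `h`, then its tail integrals are
nonnegative. -/
theorem tail_nonneg_of_superlevel {h q : ℝ → ℝ} (hh : MemLp h 2 unif) (hq : MemLp q 2 unif)
    (hhm : MonotoneOn h (Ioo 0 1)) (hqm : MonotoneOn q (Ioo 0 1)) (α : ℝ)
    (hz : ∀ v, ∫ u, {u | v < h u}.indicator (fun u => q u - α * h u) u ∂unif = 0 ∧
      ∫ u, {u | v ≤ h u}.indicator (fun u => q u - α * h u) u ∂unif = 0)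
    {a : ℝ} (ha : a ∈ Ioo (0 : ℝ) 1) : 0 ≤ ∫ u in Ioi a, (q u - α * h u) ∂unif := by
  set d : ℝ → ℝ := fun u => q u - α * h u with hd
  have hdi : Integrable d unif := MemLp.integrable_unif (hq.sub (hh.const_mul α))
  have hm := aemeasurable_of_monotoneOn hhm
  obtain ⟨z1, z2⟩ := hz (h a)
  have i1 : Integrable ({u | h a < h u}.indicator d) unif :=
    hdi.indicator₀ (nullMeasurableSet_lt aemeasurable_const hm)
  have i2 : Integrable ({u | h a ≤ h u}.indicator d) unif :=
    hdi.indicator₀ (nullMeasurableSet_le aemeasurable_const hm)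
  have i3 : Integrable ((Ioi a).indicator d) unif := hdi.indicator measurableSet_Ioi
  rw [← integral_indicator measurableSet_Ioi]
  have hlt : ∀ u ∈ Ioo (0 : ℝ) 1, h a < h u → a < u := fun u hu hau => by
    by_contra hn
    exact absurd (hhm hu ha (not_lt.1 hn)) (not_le.2 hau)
  have hge : ∀ u ∈ Ioo (0 : ℝ) 1, a < u → h a ≤ h u := fun u hu hau => hhm ha hu hau.le
  rcases le_total 0 (d a) with hda | hda
  · rw [← z1]
    refine integral_mono_ae i1 i3 ?_
    filter_upwards [ae_mem_Ioo] with u hu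
    simp only [indicator, mem_ofPred_eq, mem_Ioi]
    split_ifs with h1 h2 h2
    -- For `d a ≥ 0` the tail contains `{h > h a}`, and the surplus lies on the level set of `h` to
    -- the right of `a`, where `d` increases with `q`. For `d a ≤ 0` the tail is compared in the
    -- same way with `{h ≥ h a}`.
    · exact le_rfl
    · exact absurd (hlt u hu h1) h2
    · have e : h u = h a := le_antisymm (not_lt.1 h1) (hge u hu h2)
      have := hqm ha hu h2.le
      simp only [hd] at hda ⊢
      rw [e]; linarith
    · exact le_rfl
  · rw [← z2]
    refine integral_mono_ae i2 i3 ?_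
    filter_upwards [ae_mem_Ioo] with u hu
    simp only [indicator, mem_ofPred_eq, mem_Ioi]
    split_ifs with h1 h2 h2
    · exact le_rfl
    · have e : h u = h a := le_antisymm (hhm hu ha (not_lt.1 h2)) h1
      have := hqm hu ha (not_lt.1 h2)
      simp only [hd] at hda ⊢
      rw [e]; linarith
    · exact absurd (hge u hu h2) h1
    · exact le_rfl

/-- Both residuals integrate to zero over the superlevel sets of `h`, hence so does `q - α h`, a
multiple of their difference. Between such sets `h` is constant and `q` monotone, so all tails are
nonnegative, which suffices by `integral_mul_nonneg_of_tail`. -/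
theorem plateau_nonneg {h q r₁ r₂ w : ℝ → ℝ} (hh : MemLp h 2 unif) (hq : MemLp q 2 unif)
    (hhm : MonotoneOn h (Ioo 0 1)) (hqm : MonotoneOn q (Ioo 0 1))
    (hr₁ : MemLp r₁ 2 unif) (hr₂ : MemLp r₂ 2 unif)
    (hp₁ : ∀ w, MemLp w 2 unif → MonotoneOn w (Ioo 0 1) → ∫ u, r₁ u * w u ∂unif ≤ 0)
    (hp₂ : ∀ w, MemLp w 2 unif → MonotoneOn w (Ioo 0 1) → ∫ u, r₂ u * w u ∂unif ≤ 0)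
    (ho₁ : ∫ u, r₁ u * h u ∂unif = 0) (ho₂ : ∫ u, r₂ u * h u ∂unif = 0)
    {α : ℝ} (hm0 : ∫ u, (q u - α * h u) ∂unif = 0) {δ : ℝ} (hδ : 0 < δ)
    (hd : ∀ᵐ u ∂unif, r₂ u - r₁ u = δ * (q u - α * h u))
    (hw : MemLp w 2 unif) (hwm : MonotoneOn w (Ioo 0 1)) :
    0 ≤ ∫ u, (q u - α * h u) * w u ∂unif := by
  refine integral_mul_nonneg_of_tail (hq.sub (hh.const_mul α)) hw hwm hm0 fun a ha =>
    tail_nonneg_of_superlevel hh hq hhm hqm α (fun v => ?_) ha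
  have z1 := integral_superlevel_eq_zero hr₁ hh (integral_mul_max_sub_eq_zero hr₁ hh hhm hp₁ ho₁) v
  have z2 := integral_superlevel_eq_zero hr₂ hh (integral_mul_max_sub_eq_zero hr₂ hh hhm hp₂ ho₂) v
  have hm := aemeasurable_of_monotoneOn hhm
  have key : ∀ S : Set ℝ, NullMeasurableSet S unif → ∫ u, S.indicator r₁ u ∂unif = 0 →
      ∫ u, S.indicator r₂ u ∂unif = 0 →
      ∫ u, S.indicator (fun u => q u - α * h u) u ∂unif = 0 := by
    intro S hS h1 h2
    have i1 := (MemLp.integrable_unif hr₁).indicator₀ hS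
    have i2 := (MemLp.integrable_unif hr₂).indicator₀ hS
    have h3 : δ * ∫ u, S.indicator (fun u => q u - α * h u) u ∂unif = 0 := by
      rw [← integral_const_mul, ← sub_zero (0 : ℝ)]
      nth_rewrite 1 [← h2]
      rw [← h1, ← integral_sub i2 i1]
      refine integral_congr_ae ?_
      filter_upwards [hd] with u hu
      by_cases huS : u ∈ S
      · simp only [indicator_of_mem huS, hu]
      · simp [huS]
    exact (mul_eq_zero.1 h3).resolve_left hδ.ne'
  exact ⟨key _ (nullMeasurableSet_lt aemeasurable_const hm) z1.1 z2.1,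
    key _ (nullMeasurableSet_le aemeasurable_const hm) z1.2 z2.2⟩

/-! ### The cone of centred non-decreasing functions in `L²(0,1)` -/

/-- The constant function `1` as an element of `L²(0,1)`. -/
noncomputable def oneL2 : Lp ℝ 2 unif := (memLp_const (1 : ℝ)).toLp _

/-- The cone of centred non-decreasing functions. -/
def monoCone : Set (Lp ℝ 2 unif) :=
  {x | (∃ w : ℝ → ℝ, MonotoneOn w (Ioo 0 1) ∧ x =ᵐ[unif] w) ∧ ⟪oneL2, x⟫ = 0}

theorem inner_eq_integral (x y : Lp ℝ 2 unif) : ⟪x, y⟫ = ∫ u, x u * y u ∂unif := by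
  rw [L2.inner_def]
  congr 1; ext u
  simp [mul_comm]

theorem inner_eq_integral_of_ae {x y : Lp ℝ 2 unif} {X Y : ℝ → ℝ} (hx : x =ᵐ[unif] X)
    (hy : y =ᵐ[unif] Y) : ⟪x, y⟫ = ∫ u, X u * Y u ∂unif := by
  rw [inner_eq_integral]
  refine integral_congr_ae ?_
  filter_upwards [hx, hy] with u h1 h2
  rw [h1, h2]

theorem oneL2_ae : oneL2 =ᵐ[unif] fun _ => (1 : ℝ) := MemLp.coeFn_toLp _

theorem inner_oneL2 {x : Lp ℝ 2 unif} {X : ℝ → ℝ} (hx : x =ᵐ[unif] X) :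
    ⟪oneL2, x⟫ = ∫ u, X u ∂unif := by
  rw [inner_eq_integral_of_ae oneL2_ae hx]
  simp

theorem memLp_of_ae {x : Lp ℝ 2 unif} {X : ℝ → ℝ} (hx : x =ᵐ[unif] X) : MemLp X 2 unif :=
  (memLp_congr_ae hx).1 (Lp.memLp x)

theorem toLp_mem_monoCone {w : ℝ → ℝ} (hw : MemLp w 2 unif) (hm : MonotoneOn w (Ioo 0 1))
    (h0 : ∫ u, w u ∂unif = 0) : hw.toLp w ∈ monoCone :=
  ⟨⟨w, hm, hw.coeFn_toLp⟩, by rw [inner_oneL2 hw.coeFn_toLp, h0]⟩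

theorem isConvexCone_monoCone : IsConvexCone monoCone where
  zero_mem := ⟨⟨fun _ => 0, fun _ _ _ _ _ => le_rfl, Lp.coeFn_zero _ _ _⟩, inner_zero_right _⟩
  add_mem := by
    rintro x ⟨⟨w, hw, hxw⟩, hx0⟩ y ⟨⟨v, hv, hyv⟩, hy0⟩
    refine ⟨⟨fun u => w u + v u, hw.add hv, ?_⟩, by rw [inner_add_right, hx0, hy0, add_zero]⟩
    filter_upwards [Lp.coeFn_add x y, hxw, hyv] with u h1 h2 h3
    rw [h1, Pi.add_apply, h2, h3]
  smul_mem := by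
    rintro x ⟨⟨w, hw, hxw⟩, hx0⟩ t ht
    refine ⟨⟨fun u => t * w u, fun a ha b hb hab => mul_le_mul_of_nonneg_left (hw ha hb hab) ht,
      ?_⟩, by rw [inner_smul_right, hx0, mul_zero]⟩
    filter_upwards [Lp.coeFn_smul t x, hxw] with u h1 h2
    rw [h1, Pi.smul_apply, h2, smul_eq_mul]

/-- An `L²` limit is an a.e. limit along a subsequence, hence monotone on a set `S` of full measure.
-/
theorem isClosed_monoCone : IsClosed monoCone := by
  have h2 : IsClosed {x : Lp ℝ 2 unif | ⟪oneL2, x⟫ = 0} :=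
    isClosed_eq (continuous_const.inner continuous_id) continuous_const
  have h1 : IsClosed {x : Lp ℝ 2 unif | ∃ w : ℝ → ℝ, MonotoneOn w (Ioo 0 1) ∧ x =ᵐ[unif] w} := by
    refine IsSeqClosed.isClosed fun x y hx hxy => ?_
    choose w hw hxw using hx
    obtain ⟨ns, -, hns⟩ := (tendstoInMeasure_of_tendsto_Lp hxy).exists_seq_tendsto_ae
    have hS : ∀ᵐ u ∂unif, u ∈ Ioo (0 : ℝ) 1 ∧ Tendsto (fun k => w (ns k) u) atTop (𝓝 (y u)) := by
      filter_upwards [hns, ae_mem_Ioo, ae_all_iff.2 hxw] with u h1 h2 h3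
      exact ⟨h2, h1.congr fun k => h3 (ns k)⟩
    set S : Set ℝ := {u | u ∈ Ioo (0 : ℝ) 1 ∧ Tendsto (fun k => w (ns k) u) atTop (𝓝 (y u))}
      with hSdef
    have hmono : ∀ a ∈ S, ∀ b ∈ S, a ≤ b → y a ≤ y b := fun a ha b hb hab =>
      le_of_tendsto_of_tendsto' ha.2 hb.2 fun k => hw (ns k) ha.1 hb.1 hab
    have hne : ∀ u ∈ Ioo (0 : ℝ) 1, (y '' (S ∩ Iic u)).Nonempty := fun u hu => by
      obtain ⟨v, hv, hvS⟩ := exists_mem_Ioo_of_ae hS le_rfl hu.1 hu.2.le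
      exact ⟨y v, v, ⟨hvS, hv.2.le⟩, rfl⟩
    have hbdd : ∀ u ∈ Ioo (0 : ℝ) 1, BddAbove (y '' (S ∩ Iic u)) := fun u hu => by
      obtain ⟨v, hv, hvS⟩ := exists_mem_Ioo_of_ae hS hu.1.le hu.2 le_rfl
      refine ⟨y v, ?_⟩
      rintro _ ⟨z, ⟨hzS, hzu⟩, rfl⟩
      exact hmono z hzS v hvS (le_trans hzu hv.1.le)
    -- The supremum over the points of `S` to the left of `u` extends the limit from `S` to a
    -- monotone function on `(0,1)`.
    refine ⟨fun u => sSup (y '' (S ∩ Iic u)), fun a ha b hb hab => ?_, ?_⟩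
    · exact csSup_le_csSup (hbdd b hb) (hne a ha)
        (image_mono (inter_subset_inter_right _ (Iic_subset_Iic.2 hab)))
    · filter_upwards [hS] with u hu
      refine le_antisymm (le_csSup (hbdd u hu.1) ⟨u, ⟨hu, self_mem_Iic⟩, rfl⟩)
        (csSup_le (hne u hu.1) ?_)
      rintro _ ⟨z, ⟨hzS, hzu⟩, rfl⟩
      exact hmono z hzS u hu hzu
  exact h1.inter h2

theorem inner_nonneg_of_mem_monoCone {x y : Lp ℝ 2 unif} (hx : x ∈ monoCone) (hy : y ∈ monoCone) :
    0 ≤ ⟪x, y⟫ := by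
  obtain ⟨⟨v, hv, hxv⟩, hx0⟩ := hx
  obtain ⟨⟨w, hw, hyw⟩, -⟩ := hy
  rw [inner_oneL2 hxv] at hx0
  rw [inner_eq_integral_of_ae hxv hyw]
  exact integral_mul_nonneg_of_monotoneOn (memLp_of_ae hxv) (memLp_of_ae hyw) hv hw hx0

/-- An element of the polar cone that is orthogonal to constants is polar to all square-integrable
non-decreasing functions. -/
theorem integral_mul_nonpos_of_polar {r : Lp ℝ 2 unif} (h1 : ⟪oneL2, r⟫ = 0)
    (hp : ∀ w ∈ monoCone, ⟪r, w⟫ ≤ 0) {w : ℝ → ℝ} (hw : MemLp w 2 unif)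
    (hm : MonotoneOn w (Ioo 0 1)) : ∫ u, r u * w u ∂unif ≤ 0 := by
  set c := ∫ u, w u ∂unif with hc
  have hwc : MemLp (fun u => w u - c) 2 unif := hw.sub (memLp_const c)
  have hcm : MonotoneOn (fun u => w u - c) (Ioo 0 1) := fun a ha b hb hab =>
    sub_le_sub_right (hm ha hb hab) c
  have h0 : ∫ u, (w u - c) ∂unif = 0 := by
    rw [integral_sub (MemLp.integrable_unif hw) (integrable_const c)]
    simp [hc]
  have h2 := hp _ (toLp_mem_monoCone hwc hcm h0)
  rw [inner_eq_integral_of_ae (ae_eq_refl _) hwc.coeFn_toLp] at h2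
  rw [inner_oneL2 (ae_eq_refl _)] at h1
  have h3 : ∫ u, r u * (w u - c) ∂unif = ∫ u, r u * w u ∂unif - c * ∫ u, r u ∂unif := by
    rw [← integral_const_mul, ← integral_sub (f := fun u => r u * w u) (g := fun u => c * r u)
      ((Lp.memLp r).integrable_mul hw) ((MemLp.integrable_unif (Lp.memLp r)).const_mul c)]
    congr 1; ext u; ring
  rw [h3, h1] at h2
  linarith

theorem hasPlateauProperty_monoCone {q : Lp ℝ 2 unif} (hq : q ∈ monoCone) :
    ConePath.HasPlateauProperty monoCone oneL2 q := by
  rintro h hh r₁ r₂ α δ hδ e1 e2 p1 p2 o1 o2 hd w ⟨⟨wf, hwm, hww⟩, -⟩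
  obtain ⟨⟨qf, hqm, hqq⟩, hq0⟩ := hq
  obtain ⟨⟨hf, hhm, hhh⟩, hh0⟩ := hh
  have hdf : ∀ᵐ u ∂unif, (q - α • h : Lp ℝ 2 unif) u = qf u - α * hf u := by
    filter_upwards [Lp.coeFn_sub q (α • h), Lp.coeFn_smul α h, hqq, hhh] with u a b c d
    rw [a, Pi.sub_apply, b, Pi.smul_apply, c, d, smul_eq_mul]
  rw [inner_eq_integral_of_ae hdf hww]
  refine plateau_nonneg (memLp_of_ae hhh) (memLp_of_ae hqq) hhm hqm (Lp.memLp r₁) (Lp.memLp r₂)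
    (fun w hw hm => integral_mul_nonpos_of_polar e1 p1 hw hm)
    (fun w hw hm => integral_mul_nonpos_of_polar e2 p2 hw hm) ?_ ?_ ?_ hδ ?_ (memLp_of_ae hww) hwm
  · rw [← inner_eq_integral_of_ae (ae_eq_refl _) hhh, o1]
  · rw [← inner_eq_integral_of_ae (ae_eq_refl _) hhh, o2]
  · rw [← inner_oneL2 hdf, inner_sub_right, inner_smul_right, hq0, hh0]; simp
  · filter_upwards [Lp.coeFn_sub r₂ r₁, Lp.coeFn_smul δ (q - α • h), hdf] with u a b c
    rw [← c, ← Pi.sub_apply, ← a, hd, b, Pi.smul_apply, smul_eq_mul]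

/-! ### Centring -/

theorem memLp_sub_mean {X : ℝ → ℝ} (hX : MemLp X 2 unif) :
    MemLp (fun u => X u - mean X) 2 unif := hX.sub (memLp_const _)

/-- The centred function `X - E(X(U))` as an element of `L²(0,1)`. -/
noncomputable def centre {X : ℝ → ℝ} (hX : MemLp X 2 unif) : Lp ℝ 2 unif :=
  (memLp_sub_mean hX).toLp _

theorem centre_ae {X : ℝ → ℝ} (hX : MemLp X 2 unif) :
    centre hX =ᵐ[unif] fun u => X u - mean X := MemLp.coeFn_toLp _

theorem mean_const (c : ℝ) : mean (fun _ => c) = c := by simp [mean]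

theorem mean_sub {X Y : ℝ → ℝ} (hX : MemLp X 2 unif) (hY : MemLp Y 2 unif) :
    mean (fun u => X u - Y u) = mean X - mean Y :=
  integral_sub (MemLp.integrable_unif hX) (MemLp.integrable_unif hY)

theorem mean_congr {X Y : ℝ → ℝ} (h : X =ᵐ[unif] Y) : mean X = mean Y := integral_congr_ae h

theorem mean_sub_mean {X : ℝ → ℝ} (hX : MemLp X 2 unif) :
    ∫ u, (X u - mean X) ∂unif = 0 := by
  have := mean_sub hX (memLp_const (mean X))
  rw [mean_const, sub_self] at this
  exact this

theorem inner_oneL2_centre {X : ℝ → ℝ} (hX : MemLp X 2 unif) : ⟪oneL2, centre hX⟫ = 0 := by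
  rw [inner_oneL2 (centre_ae hX), mean_sub_mean hX]

theorem centre_mem_monoCone {X : ℝ → ℝ} (hX : MemLp X 2 unif) (hm : MonotoneOn X (Ioo 0 1)) :
    centre hX ∈ monoCone :=
  toLp_mem_monoCone _ (fun _ ha _ hb hab => sub_le_sub_right (hm ha hb hab) _) (mean_sub_mean hX)

theorem inner_centre {X Y : ℝ → ℝ} (hX : MemLp X 2 unif) (hY : MemLp Y 2 unif) :
    ⟪centre hX, centre hY⟫ = covariance X Y unif :=
  inner_eq_integral_of_ae (centre_ae hX) (centre_ae hY)

theorem inner_centre_eq_sub {X Y : ℝ → ℝ} (hX : MemLp X 2 unif) (hY : MemLp Y 2 unif) :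
    ⟪centre hX, centre hY⟫ = (∫ u, X u * Y u ∂unif) - mean X * mean Y := by
  rw [inner_centre, covariance_eq_sub hX hY]; rfl

theorem norm_centre {X : ℝ → ℝ} (hX : MemLp X 2 unif) : ‖centre hX‖ = std X := by
  rw [std, ← covariance_self hX.1.aemeasurable, ← inner_centre hX hX, real_inner_self_eq_norm_sq,
    Real.sqrt_sq (norm_nonneg _)]

theorem norm_centre_sq {X : ℝ → ℝ} (hX : MemLp X 2 unif) :
    ‖centre hX‖ ^ 2 = (∫ u, X u ^ 2 ∂unif) - mean X ^ 2 := by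
  rw [← real_inner_self_eq_norm_sq, inner_centre_eq_sub]
  simp_rw [sq]

theorem corr_eq_cosine {X Y : ℝ → ℝ} (hX : MemLp X 2 unif) (hY : MemLp Y 2 unif) :
    corr X Y = cosine (centre hX) (centre hY) := by
  rw [corr, cosine, inner_centre, norm_centre, norm_centre]

theorem centre_congr {X Y : ℝ → ℝ} (hX : MemLp X 2 unif) (hY : MemLp Y 2 unif)
    (h : X =ᵐ[unif] Y) : centre hX = centre hY := by
  refine Lp.ext ?_
  filter_upwards [centre_ae hX, centre_ae hY, h] with u h1 h2 h3
  rw [h1, h2, h3, mean_congr h]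

theorem ae_eq_of_centre_eq {X Y : ℝ → ℝ} (hX : MemLp X 2 unif) (hY : MemLp Y 2 unif)
    (h : centre hX = centre hY) (hm : mean X = mean Y) : X =ᵐ[unif] Y := by
  filter_upwards [centre_ae hX, centre_ae hY] with u h1 h2
  rw [h, h2, hm] at h1
  linarith

theorem mean_eq_of_ae {X : ℝ → ℝ} {x : Lp ℝ 2 unif} {c : ℝ}
    (hx : ⟪oneL2, x⟫ = 0) (h : X =ᵐ[unif] fun u => x u + c) : mean X = c := by
  have hxm : mean x = 0 := by rw [← hx, inner_oneL2 (ae_eq_refl _)]; rfl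
  rw [mean_congr h]
  have := integral_add (MemLp.integrable_unif (Lp.memLp x)) (integrable_const (μ := unif) c)
  rw [mean, this]
  change mean x + _ = c
  rw [hxm]; simp

theorem centre_eq_of_ae {X : ℝ → ℝ} (hX : MemLp X 2 unif) {x : Lp ℝ 2 unif} {c : ℝ}
    (hx : ⟪oneL2, x⟫ = 0) (h : X =ᵐ[unif] fun u => x u + c) : centre hX = x := by
  have hmean := mean_eq_of_ae hx h
  refine Lp.ext ?_
  filter_upwards [centre_ae hX, h] with u h1 h2
  rw [h1, h2, hmean, add_sub_cancel_right]

/-- Bias-variance decomposition of the squared distance. -/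
theorem integral_sq_sub {X Y : ℝ → ℝ} (hX : MemLp X 2 unif) (hY : MemLp Y 2 unif) :
    ∫ u, (X u - Y u) ^ 2 ∂unif = ‖centre hX - centre hY‖ ^ 2 + (mean X - mean Y) ^ 2 := by
  have hXY : MemLp (fun u => X u - Y u) 2 unif := hX.sub hY
  have h : centre hX - centre hY = centre hXY := by
    refine Lp.ext ?_
    filter_upwards [Lp.coeFn_sub (centre hX) (centre hY), centre_ae hX, centre_ae hY,
      centre_ae hXY] with u h1 h2 h3 h4
    rw [h1, Pi.sub_apply, h2, h3, h4, mean_sub hX hY]; ring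
  rw [h, norm_centre_sq, mean_sub hX hY, sub_add_cancel]

/-! ### Moments and distances in terms of quantile functions -/

theorem hasMoments_lawOf {w : ℝ → ℝ} (hw : MemLp w 2 unif) {m s : ℝ} (hm : mean w = m)
    (hs : ‖centre hw‖ = s) : HasMoments (lawOf w) m s where
  isProbabilityMeasure := isProbabilityMeasure_lawOf hw.1.aemeasurable
  memLp := by
    rw [lawOf, memLp_map_measure_iff (g := fun x : ℝ => x) aestronglyMeasurable_id hw.1.aemeasurable]
    exact hw
  first := by
    rw [lawOf, integral_map hw.1.aemeasurable (by fun_prop)]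
    exact hm
  second := by
    rw [lawOf, integral_map hw.1.aemeasurable (by fun_prop)]
    have := norm_centre_sq hw
    rw [hs, hm] at this
    linarith

theorem HasMoments.memLp_quantile {G : Measure ℝ} {m s : ℝ} (h : HasMoments G m s) :
    MemLp (quantile G) 2 unif := by
  have := h.isProbabilityMeasure
  have hm := aemeasurable_of_monotoneOn (monotoneOn_quantile G)
  have h1 := h.memLp
  rw [← lawOf_quantile G, lawOf, memLp_map_measure_iff (g := fun x : ℝ => x) aestronglyMeasurable_id hm] at h1
  exact h1

theorem HasMoments.mean_quantile {G : Measure ℝ} {m s : ℝ} (h : HasMoments G m s) :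
    mean (quantile G) = m := by
  have := h.isProbabilityMeasure
  have hm := aemeasurable_of_monotoneOn (monotoneOn_quantile G)
  have h1 := h.first
  rw [← lawOf_quantile G, lawOf, integral_map hm (by fun_prop)] at h1
  exact h1

theorem HasMoments.norm_centre_quantile {G : Measure ℝ} {m s : ℝ} (h : HasMoments G m s)
    (hs : 0 ≤ s) : ‖centre h.memLp_quantile‖ = s := by
  have := h.isProbabilityMeasure
  have hm := aemeasurable_of_monotoneOn (monotoneOn_quantile G)
  have h1 := h.second
  rw [← lawOf_quantile G, lawOf, integral_map hm (by fun_prop)] at h1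
  have h2 := norm_centre_sq h.memLp_quantile
  rw [h1, h.mean_quantile, add_sub_cancel_left] at h2
  exact (sq_eq_sq₀ (norm_nonneg _) hs).1 h2

theorem HasMoments.centre_mem {G : Measure ℝ} {m s : ℝ} (h : HasMoments G m s) :
    centre h.memLp_quantile ∈ monoCone :=
  centre_mem_monoCone _ (monotoneOn_quantile G)

/-- With both means and norms fixed, only the angle between the centred quantile functions is free
in the squared distance. -/
theorem HasMoments.wasserstein_eq {F G : Measure ℝ} {m s m' s' : ℝ} (hF : HasMoments F m s)
    (hG : HasMoments G m' s') (hs : 0 < s) (hs' : 0 < s') :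
    wasserstein F G = ENNReal.ofReal ((m - m') ^ 2 + (s - s') ^ 2
      + 2 * s' * s * (1 - cosine (centre hF.memLp_quantile) (centre hG.memLp_quantile)))
        ^ (1 / 2 : ℝ) := by
  have := hF.isProbabilityMeasure
  have := hG.isProbabilityMeasure
  have hd : MemLp (fun u => quantile F u - quantile G u) 2 unif :=
    hF.memLp_quantile.sub hG.memLp_quantile
  rw [DistortionBounds.wasserstein_eq,
    ← ofReal_integral_eq_lintegral_ofReal hd.integrable_sq
      (Eventually.of_forall fun u => sq_nonneg _)]
  congr 2
  have h1 := integral_sq_sub hF.memLp_quantile hG.memLp_quantile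
  have hFn := hF.norm_centre_quantile hs.le
  have hGn := hG.norm_centre_quantile hs'.le
  have h2 : cosine (centre hF.memLp_quantile) (centre hG.memLp_quantile) * (s * s')
      = ⟪centre hF.memLp_quantile, centre hG.memLp_quantile⟫ := by
    have := cosine_mul (x := centre hF.memLp_quantile) (y := centre hG.memLp_quantile)
      (norm_ne_zero_iff.1 (by rw [hFn]; exact hs.ne'))
      (norm_ne_zero_iff.1 (by rw [hGn]; exact hs'.ne'))
    rwa [hFn, hGn] at this
  rw [norm_sub_sq_real, ← h2, hFn, hGn, hF.mean_quantile, hG.mean_quantile] at h1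
  rw [h1]; ring

theorem HasMoments.riskMeasure_eq {g : ℝ → ℝ} (hg : IsDistortion g)
    (hgac : AbsolutelyContinuousOnInterval g 0 1) (hγ : MemLp (weight g) 2 unif)
    {G : Measure ℝ} {m s : ℝ} (h : HasMoments G m s) :
    riskMeasure g G = ⟪centre hγ, centre h.memLp_quantile⟫ + m := by
  rw [(DistortionBounds.riskMeasure_eq hg hgac hγ G h.memLp_quantile).2.2, inner_centre_eq_sub,
    h.mean_quantile]
  have : mean (weight g) = 1 := integral_weight hg hgac
  rw [this]; ring

/-! ### Antitonic projections -/

theorem IsAntitonic.monotoneOn_neg {k : ℝ → ℝ} (h : IsAntitonic k) :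
    MonotoneOn (fun u => -k u) (Ioo 0 1) := h.antitoneOn.neg

theorem IsAntitonic.memLp_neg {k : ℝ → ℝ} (h : IsAntitonic k) :
    MemLp (fun u => -k u) 2 unif := h.memLp.neg

theorem IsAntitonic.eqOn_of_ae {k k' : ℝ → ℝ} (h : IsAntitonic k) (h' : IsAntitonic k')
    (hae : k =ᵐ[unif] k') : EqOn k k' (Ioo 0 1) := fun u hu => by
  have := eqOn_of_ae_eq h.monotoneOn_neg (fun u hu => (h.leftCont u hu).neg) h'.monotoneOn_neg
    (fun u hu => (h'.leftCont u hu).neg) (hae.fun_neg) hu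
  simpa using this

theorem mean_neg (X : ℝ → ℝ) : mean (fun u => -X u) = -mean X := integral_neg X

theorem centre_neg {X : ℝ → ℝ} (hX : MemLp X 2 unif) (hX' : MemLp (fun u => -X u) 2 unif) :
    centre hX' = -centre hX := by
  refine Lp.ext ?_
  filter_upwards [Lp.coeFn_neg (centre hX), centre_ae hX, centre_ae hX'] with u h1 h2 h3
  rw [h1, Pi.neg_apply, h2, h3, mean_neg]; ring

/-- The squared distance between `f` and an antitonic function, in terms of centred functions. -/
theorem IsAntitonic.integral_sq_sub {f k : ℝ → ℝ} (hf : MemLp f 2 unif) (hk : IsAntitonic k) :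
    ∫ u, (f u - k u) ^ 2 ∂unif
      = ‖-centre hf - centre hk.memLp_neg‖ ^ 2 + (mean f - mean k) ^ 2 := by
  rw [DistortionBounds.integral_sq_sub hf hk.memLp, centre_neg hk.memLp, ← norm_neg]
  congr 3; abel

/-- The antitonic projection is the mean of the function minus the projection of the negative
centred function onto the cone of centred non-decreasing functions. -/
theorem isAntitonicProj_of_isConeProj {f k : ℝ → ℝ} (hf : MemLp f 2 unif) {x : Lp ℝ 2 unif}
    (hx : IsConeProj monoCone (-centre hf) x) (hk : IsAntitonic k) (hmean : mean k = mean f)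
    (hkx : centre hk.memLp_neg = x) : IsAntitonicProj f k := by
  refine ⟨hk, fun k' hk' => ?_⟩
  rw [hk.integral_sq_sub hf, hk'.integral_sq_sub hf, hmean, hkx]
  have := hx.norm_sub_sq_le (centre_mem_monoCone hk'.memLp_neg hk'.monotoneOn_neg)
  have := sq_nonneg ‖centre hk'.memLp_neg - x‖
  have := sq_nonneg (mean f - mean k')
  nlinarith

/-- The quantile function of the law of a representative is a left-continuous representative. -/
theorem exists_antitonic_of_mem_monoCone {x : Lp ℝ 2 unif} (hx : x ∈ monoCone) (a : ℝ) :
    ∃ k, ∃ hk : IsAntitonic k, mean k = a ∧ centre hk.memLp_neg = x := by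
  obtain ⟨⟨w, hw, hxw⟩, hx0⟩ := hx
  set W := quantile (lawOf w) with hW
  have hWw : W =ᵐ[unif] w := quantile_lawOf_ae hw
  have hWx : W =ᵐ[unif] x := hWw.trans hxw.symm
  have hWL : MemLp W 2 unif := (memLp_congr_ae hWx).2 (Lp.memLp x)
  have hk : IsAntitonic fun u => a - W u :=
    ⟨(memLp_const a).sub hWL, fun u hu v hv huv =>
      sub_le_sub_left (monotoneOn_quantile _ hu hv huv) a,
      fun u hu => continuousWithinAt_const.sub (leftCont_quantile _ hu)⟩
  refine ⟨_, hk, ?_, centre_eq_of_ae _ (c := -a) hx0 ?_⟩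
  · rw [mean_sub (memLp_const a) hWL, mean_const, mean_congr hWx]
    rw [inner_oneL2 (ae_eq_refl _)] at hx0
    rw [mean, hx0, sub_zero]
  · filter_upwards [hWx] with u hu
    rw [hu]; ring

theorem exists_isAntitonicProj {f : ℝ → ℝ} (hf : MemLp f 2 unif) : ∃ k, IsAntitonicProj f k := by
  obtain ⟨x, hx⟩ := isConvexCone_monoCone.exists_isConeProj isClosed_monoCone (-centre hf)
  obtain ⟨k, hk, hmean, hkx⟩ := exists_antitonic_of_mem_monoCone hx.mem (mean f)
  exact ⟨k, isAntitonicProj_of_isConeProj hf hx hk hmean hkx⟩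

/-- The squared distance splits into a mean part and a centred part, which are minimised
independently; comparison with the explicit competitor forces both excesses to vanish. -/
theorem IsAntitonicProj.mean_eq_and_centre_eq {f k : ℝ → ℝ} (hf : MemLp f 2 unif)
    {x : Lp ℝ 2 unif} (hx : IsConeProj monoCone (-centre hf) x) (h : IsAntitonicProj f k) :
    mean k = mean f ∧ centre h.isAntitonic.memLp_neg = x := by
  obtain ⟨k', hk', hmean, hkx⟩ := exists_antitonic_of_mem_monoCone hx.mem (mean f)
  have h1 := h.le k' hk'
  rw [hk'.integral_sq_sub hf, h.isAntitonic.integral_sq_sub hf, hmean, hkx] at h1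
  have h2 := hx.norm_sub_sq_le
    (centre_mem_monoCone h.isAntitonic.memLp_neg h.isAntitonic.monotoneOn_neg)
  have h3 := sq_nonneg ‖centre h.isAntitonic.memLp_neg - x‖
  have h4 := sq_nonneg (mean f - mean k)
  have e1 : (mean f - mean k) ^ 2 = 0 := by nlinarith
  have e2 : ‖centre h.isAntitonic.memLp_neg - x‖ ^ 2 = 0 := by nlinarith
  constructor
  · have := pow_eq_zero_iff two_ne_zero |>.1 e1
    linarith
  · exact sub_eq_zero.1 (norm_eq_zero.1 (pow_eq_zero_iff two_ne_zero |>.1 e2))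

theorem IsAntitonicProj.eqOn {f k k' : ℝ → ℝ} (hf : MemLp f 2 unif) (h : IsAntitonicProj f k)
    (h' : IsAntitonicProj f k') : EqOn k k' (Ioo 0 1) := by
  obtain ⟨x, hx⟩ := isConvexCone_monoCone.exists_isConeProj isClosed_monoCone (-centre hf)
  obtain ⟨m1, c1⟩ := h.mean_eq_and_centre_eq hf hx
  obtain ⟨m2, c2⟩ := h'.mean_eq_and_centre_eq hf hx
  refine h.isAntitonic.eqOn_of_ae h'.isAntitonic ?_
  have := ae_eq_of_centre_eq h.isAntitonic.memLp_neg h'.isAntitonic.memLp_neg (c1.trans c2.symm)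
    (by rw [mean_neg, mean_neg, m1, m2])
  filter_upwards [this] with u hu
  exact neg_injective hu

theorem IsAntitonic.isConst_iff {k : ℝ → ℝ} (hk : IsAntitonic k) :
    IsConst k ↔ centre hk.memLp_neg = 0 := by
  constructor
  · rintro ⟨c, hc⟩
    refine centre_eq_of_ae _ (c := -c) (inner_zero_right _) ?_
    filter_upwards [ae_mem_Ioo, Lp.coeFn_zero ℝ 2 unif] with u hu h0
    rw [hc u hu, h0]; simp
  · intro h
    refine ⟨mean k, hk.eqOn_of_ae (k' := fun _ => mean k)
      ⟨memLp_const _, fun _ _ _ _ _ => le_rfl, fun _ _ => continuousWithinAt_const⟩ ?_⟩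
    have := centre_ae hk.memLp_neg
    rw [h] at this
    filter_upwards [this, Lp.coeFn_zero ℝ 2 unif] with u h1 h0
    rw [h0, mean_neg] at h1
    simp only [Pi.zero_apply] at h1
    linarith

/-! ### The path of antitonic projections and the active and unconstrained cases -/

section Path

variable {g : ℝ → ℝ} {F : Measure ℝ} {μF σF μ σ : ℝ}

theorem memLp_target (hγ : MemLp (weight g) 2 unif) (hQ : MemLp (quantile F) 2 unif) (l : ℝ) :
    MemLp (target g F l) 2 unif := hγ.sub (hQ.const_mul l)

theorem neg_centre_target (hγ : MemLp (weight g) 2 unif) (hQ : MemLp (quantile F) 2 unif)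
    (l : ℝ) : -centre (memLp_target hγ hQ l) = l • centre hQ - centre hγ := by
  have h : centre (memLp_target hγ hQ l) = centre hγ - l • centre hQ := by
    refine centre_eq_of_ae _ (c := mean (weight g) - l * mean (quantile F)) ?_ ?_
    · rw [inner_sub_right, inner_smul_right, inner_oneL2_centre, inner_oneL2_centre]; simp
    · filter_upwards [Lp.coeFn_sub (centre hγ) (l • centre hQ), Lp.coeFn_smul l (centre hQ),
        centre_ae hγ, centre_ae hQ] with u h1 h2 h3 h4
      rw [h1, Pi.sub_apply, h2, Pi.smul_apply, h3, h4, target, smul_eq_mul]; ring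
  rw [h, neg_sub]

theorem isAntitonicProj_kDown (hγ : MemLp (weight g) 2 unif) (hQ : MemLp (quantile F) 2 unif)
    (l : ℝ) : IsAntitonicProj (target g F l) (kDown g F l) :=
  Classical.epsilon_spec (exists_isAntitonicProj (memLp_target hγ hQ l))

theorem exists_conePath (hγ : MemLp (weight g) 2 unif) (hσF : 0 < σF)
    (hF : HasMoments F μF σF) :
    ∃ m, ConePath monoCone oneL2 (centre hF.memLp_quantile) (centre hγ) m := by
  choose m hm using fun l : ℝ => isConvexCone_monoCone.exists_isConeProj isClosed_monoCone
    (l • centre hF.memLp_quantile - centre hγ)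
  refine ⟨m, isConvexCone_monoCone, fun x hx y hy => inner_nonneg_of_mem_monoCone hx hy,
    fun x hx => hx.2, inner_oneL2_centre hγ, hF.centre_mem, ?_, hm⟩
  rw [← norm_ne_zero_iff, hF.norm_centre_quantile hσF.le]
  exact hσF.ne'

variable {hγ : MemLp (weight g) 2 unif} {hQ : MemLp (quantile F) 2 unif} {m : ℝ → Lp ℝ 2 unif}

theorem centre_neg_kDown (P : ConePath monoCone oneL2 (centre hQ) (centre hγ) m)
    (l : ℝ) (hk : IsAntitonic (kDown g F l)) : centre hk.memLp_neg = m l := by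
  have hx := P.proj l
  rw [← neg_centre_target hγ hQ l] at hx
  exact ((isAntitonicProj_kDown hγ hQ l).mean_eq_and_centre_eq _ hx).2

theorem isConst_kDown_iff
    (P : ConePath monoCone oneL2 (centre hQ) (centre hγ) m) (l : ℝ) :
    IsConst (kDown g F l) ↔ m l = 0 := by
  have hk := (isAntitonicProj_kDown hγ hQ l).isAntitonic
  rw [hk.isConst_iff, centre_neg_kDown P l hk]

/-- The infimum gives a parameter below `l` with nonzero projection, and by `ConePath.eq_zero_of_le`
a zero of the path would spread to everything below it. -/
theorem ne_zero_of_lamDown_eq_zero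
    (P : ConePath monoCone oneL2 (centre hQ) (centre hγ) m)
    (hlam : lamDown g F = 0) {l : ℝ} (hl : 0 < l) : m l ≠ 0 := by
  intro h0
  have h1 : lamDown g F < (l : EReal) := by rw [hlam]; exact_mod_cast hl
  rw [lamDown] at h1
  simp only [iInf_lt_iff] at h1
  obtain ⟨l', ⟨-, hl'⟩, hlt⟩ := h1
  rw [isConst_kDown_iff P] at hl'
  exact hl' (P.eq_zero_of_le h0 (by exact_mod_cast hlt.le))

theorem corr_quantile_neg_kDown
    (P : ConePath monoCone oneL2 (centre hQ) (centre hγ) m) (l : ℝ) :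
    corr (quantile F) (fun u => -kDown g F l u)
      = cosine (centre hQ) (m l) := by
  have hk := (isAntitonicProj_kDown hγ hQ l).isAntitonic
  rw [corr_eq_cosine hQ hk.memLp_neg, centre_neg_kDown P l hk]

theorem std_kDown
    (P : ConePath monoCone oneL2 (centre hQ) (centre hγ) m) (l : ℝ) :
    std (kDown g F l) = ‖m l‖ := by
  have hk := (isAntitonicProj_kDown hγ hQ l).isAntitonic
  rw [← norm_centre hk.memLp, ← centre_neg_kDown P l hk, centre_neg hk.memLp, norm_neg]

theorem std_mul_corr_weight_kDown (hstd : std (weight g) ≠ 0)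
    (P : ConePath monoCone oneL2 (centre hQ) (centre hγ) m) {l : ℝ} :
    σ * std (weight g) * corr (weight g) (kDown g F l)
      = -⟪centre hγ, (σ / ‖m l‖) • m l⟫ := by
  have hk := (isAntitonicProj_kDown hγ hQ l).isAntitonic
  have h1 : covariance (weight g) (kDown g F l) unif = -⟪centre hγ, m l⟫ := by
    rw [← inner_centre hγ hk.memLp, ← centre_neg_kDown P l hk, centre_neg hk.memLp,
      inner_neg_right, neg_neg]
  rw [corr, h1, std_kDown P, inner_smul_right]
  field_simp

/-- The law with mean `μ` and standard deviation `σ` in a given direction of the cone. -/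
theorem exists_law_of_direction (μ : ℝ) (hσ : 0 < σ) {v : Lp ℝ 2 unif} (hv : v ∈ monoCone)
    (hv0 : v ≠ 0) :
    ∃ G, ∃ hG : HasMoments G μ σ, centre hG.memLp_quantile = (σ / ‖v‖) • v := by
  have hvC : (σ / ‖v‖) • v ∈ monoCone :=
    isConvexCone_monoCone.smul_mem _ hv _ (by positivity)
  obtain ⟨⟨w, hw, hvw⟩, h0⟩ := hvC
  have hwL := memLp_of_ae hvw
  have hn : ‖(σ / ‖v‖) • v‖ = σ := by
    rw [norm_smul, Real.norm_of_nonneg (by positivity),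
      div_mul_cancel₀ _ (norm_ne_zero_iff.2 hv0)]
  have hw' : MemLp (fun u => w u + μ) 2 unif := hwL.add (memLp_const μ)
  have hae : (fun u => w u + μ) =ᵐ[unif] fun u => ((σ / ‖v‖) • v : Lp ℝ 2 unif) u + μ := by
    filter_upwards [hvw] with u hu
    rw [hu]
  have hc : centre hw' = (σ / ‖v‖) • v := centre_eq_of_ae _ h0 hae
  have hmono : MonotoneOn (fun u => w u + μ) (Ioo 0 1) := fun a ha b hb hab =>
    add_le_add_left (hw ha hb hab) μ
  have hM := hasMoments_lawOf hw' (mean_eq_of_ae h0 hae) (by rw [hc, hn])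
  exact ⟨_, hM, (centre_congr _ hw' (quantile_lawOf_ae hmono)).trans hc⟩

theorem hDown_spec (hσ : 0 < σ)
    (P : ConePath monoCone oneL2 (centre hQ) (centre hγ) m) {l : ℝ}
    (hl : m l ≠ 0) : EqOn (quantile (lawOf (hDown g F μ σ l))) (hDown g F μ σ l) (Ioo 0 1) ∧
      ∃ hG : HasMoments (lawOf (hDown g F μ σ l)) μ σ,
        centre hG.memLp_quantile = (σ / ‖m l‖) • m l := by
  have hk := (isAntitonicProj_kDown hγ hQ l).isAntitonic
  have hn : 0 < ‖m l‖ := norm_pos_iff.2 hl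
  have hform : ∀ u, hDown g F μ σ l u
      = (σ / ‖m l‖) * (-kDown g F l u + mean (kDown g F l)) + μ := by
    intro u
    rw [hDown, std_kDown P]; ring
  have hL : MemLp (hDown g F μ σ l) 2 unif := by
    have : MemLp (fun u => (σ / ‖m l‖) * (-kDown g F l u + mean (kDown g F l)) + μ) 2 unif :=
      ((hk.memLp_neg.add (memLp_const _)).const_mul _).add (memLp_const μ)
    exact (memLp_congr_ae (Eventually.of_forall hform)).2 this
  have hmono : MonotoneOn (hDown g F μ σ l) (Ioo 0 1) := fun a ha b hb hab => by
    rw [hform, hform]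
    have := hk.antitoneOn ha hb hab
    have h : 0 ≤ σ / ‖m l‖ := by positivity
    gcongr
  have hcont : ∀ u ∈ Ioo (0 : ℝ) 1, ContinuousWithinAt (hDown g F μ σ l) (Iic u) u := fun u hu =>
    (((hk.leftCont u hu).neg.add continuousWithinAt_const).const_mul _ |>.add
      continuousWithinAt_const).congr (fun v _ => hform v) (hform u)
  have hq := quantile_lawOf_eqOn hmono hcont
  have hC : (σ / ‖m l‖) • m l ∈ monoCone :=
    isConvexCone_monoCone.smul_mem _ (P.proj l).mem _ (by positivity)
  have hae : hDown g F μ σ l =ᵐ[unif] fun u => ((σ / ‖m l‖) • m l : Lp ℝ 2 unif) u + μ := by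
    have h1 := centre_ae hk.memLp_neg
    rw [centre_neg_kDown P l hk] at h1
    filter_upwards [Lp.coeFn_smul (σ / ‖m l‖) (m l), h1] with u h2 h3
    rw [h2, Pi.smul_apply, h3, hform, mean_neg, smul_eq_mul]; ring
  have hc : centre hL = (σ / ‖m l‖) • m l := centre_eq_of_ae _ hC.2 hae
  have hM := hasMoments_lawOf hL (mean_eq_of_ae hC.2 hae) (by
    rw [hc, norm_smul, Real.norm_of_nonneg (by positivity), div_mul_cancel₀ _ hn.ne'] : _ = σ)
  exact ⟨hq, hM, (centre_congr _ hL (eqOn_ae hq)).trans hc⟩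

/-- Laws with the same moments and the same centred quantile function agree. -/
theorem HasMoments.eq_of_centre_eq {G G' : Measure ℝ} (hG : HasMoments G μ σ)
    (hG' : HasMoments G' μ σ) (h : centre hG.memLp_quantile = centre hG'.memLp_quantile) :
    G = G' := by
  have := hG.isProbabilityMeasure
  have := hG'.isProbabilityMeasure
  rw [← lawOf_quantile G, ← lawOf_quantile G']
  exact lawOf_congr (ae_eq_of_centre_eq _ _ h (hG.mean_quantile.trans hG'.mean_quantile.symm))

/-- The squared Wasserstein distance as a function of the correlation of the quantile functions. -/
def sqDist (μF σF μ σ K : ℝ) : ℝ := (μF - μ) ^ 2 + (σF - σ) ^ 2 + 2 * σ * σF * (1 - K)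

theorem sqDist_nonneg (hσF : 0 < σF) (hσ : 0 < σ) {K : ℝ} (hK : K ≤ 1) :
    0 ≤ sqDist μF σF μ σ K := by
  have : 0 ≤ 1 - K := by linarith
  unfold sqDist; positivity

theorem sqDist_le_iff (hσF : 0 < σF) (hσ : 0 < σ) {K K' : ℝ} :
    sqDist μF σF μ σ K ≤ sqDist μF σF μ σ K' ↔ K' ≤ K := by
  have : 0 < 2 * σ * σF := by positivity
  unfold sqDist
  constructor
  · intro h
    by_contra hn
    have := mul_lt_mul_of_pos_left (not_le.1 hn) this
    linarith
  · intro h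
    have := mul_le_mul_of_nonneg_left h this.le
    linarith

theorem ofReal_sqDist_le_iff (hσF : 0 < σF) (hσ : 0 < σ) {K K' : ℝ} (hK' : K' ≤ 1) :
    ENNReal.ofReal (sqDist μF σF μ σ K) ≤ ENNReal.ofReal (sqDist μF σF μ σ K') ↔ K' ≤ K := by
  rw [ENNReal.ofReal_le_ofReal_iff (sqDist_nonneg hσF hσ hK'), sqDist_le_iff hσF hσ]

theorem mem_uncertaintySet_iff (hσF : 0 < σF) (hσ : 0 < σ) (hF : HasMoments F μF σF)
    {G : Measure ℝ} (hG : HasMoments G μ σ) {ε : ℝ≥0∞} :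
    G ∈ uncertaintySet F μ σ ε ↔ ENNReal.ofReal (sqDist μF σF μ σ
      (cosine (centre hF.memLp_quantile) (centre hG.memLp_quantile))) ≤ ε := by
  rw [← ENNReal.rpow_le_rpow_iff (z := (1 / 2 : ℝ)) (by norm_num)]
  constructor
  · intro h
    have := h.2
    rwa [hF.wasserstein_eq hG hσF hσ] at this
  · intro h
    refine ⟨hG, ?_⟩
    rwa [hF.wasserstein_eq hG hσF hσ]

theorem wasserstein_hDown (hF : HasMoments F μF σF) (hσF : 0 < σF) (hσ : 0 < σ)
    (P : ConePath monoCone oneL2 (centre hF.memLp_quantile) (centre hγ) m) {l : ℝ}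
    (hl : m l ≠ 0) : wasserstein F (lawOf (hDown g F μ σ l)) = ENNReal.ofReal
      (sqDist μF σF μ σ (cosine (centre hF.memLp_quantile) (m l))) ^ (1 / 2 : ℝ) := by
  obtain ⟨-, hG, hc⟩ := hDown_spec (μ := μ) hσ P hl
  rw [hF.wasserstein_eq hG hσF hσ, hc, cosine_smul_right _ _ (div_pos hσ (norm_pos_iff.2 hl))]
  rfl

theorem riskMeasure_hDown (hg : IsDistortion g) (hgac : AbsolutelyContinuousOnInterval g 0 1)
    (hσ : 0 < σ) (P : ConePath monoCone oneL2 (centre hQ) (centre hγ) m) {l : ℝ}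
    (hl : m l ≠ 0) : riskMeasure g (lawOf (hDown g F μ σ l))
      = ⟪centre hγ, (σ / ‖m l‖) • m l⟫ + μ := by
  obtain ⟨-, hG, hc⟩ := hDown_spec (μ := μ) hσ P hl
  rw [hG.riskMeasure_eq hg hgac hγ, hc]

theorem hDown_mem_uncertaintySet (hF : HasMoments F μF σF) (hσF : 0 < σF) (hσ : 0 < σ)
    (P : ConePath monoCone oneL2 (centre hF.memLp_quantile) (centre hγ) m) {l : ℝ}
    (hl : m l ≠ 0) {ε : ℝ≥0∞}
    (hε : ENNReal.ofReal (sqDist μF σF μ σ (cosine (centre hF.memLp_quantile) (m l))) ≤ ε) :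
    lawOf (hDown g F μ σ l) ∈ uncertaintySet F μ σ ε := by
  obtain ⟨-, hG, hc⟩ := hDown_spec (μ := μ) hσ P hl
  rw [mem_uncertaintySet_iff hσF hσ hF hG, hc,
    cosine_smul_right _ _ (div_pos hσ (norm_pos_iff.2 hl))]
  exact hε

/-- Complementary slackness: a positive multiplier requires the radius to match the distance of the
candidate exactly, while for `l = 0` feasibility is enough. -/
theorem solvedBy_of_cosine (hg : IsDistortion g) (hgac : AbsolutelyContinuousOnInterval g 0 1)
    (hstd : std (weight g) ≠ 0) (hF : HasMoments F μF σF) (hσF : 0 < σF) (hσ : 0 < σ)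
    (P : ConePath monoCone oneL2 (centre hF.memLp_quantile) (centre hγ) m) {l : ℝ} (hl0 : 0 ≤ l)
    (hl : m l ≠ 0) {ε : ℝ≥0∞}
    (hε : ENNReal.ofReal (sqDist μF σF μ σ (cosine (centre hF.memLp_quantile) (m l))) ≤ ε)
    (hεl : l ≠ 0 →
      ε ≤ ENNReal.ofReal (sqDist μF σF μ σ (cosine (centre hF.memLp_quantile) (m l)))) :
    SolvedBy g F μ σ ε l := by
  obtain ⟨hq, hG, hc⟩ := hDown_spec (μ := μ) hσ P hl
  have hrisk := riskMeasure_hDown (μ := μ) hg hgac hσ P hl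
  have hmem := hDown_mem_uncertaintySet hF hσF hσ P hl hε
  have hopt : ∀ G' ∈ uncertaintySet F μ σ ε,
      riskMeasure g (lawOf (hDown g F μ σ l)) ≤ riskMeasure g G' ∧
      (riskMeasure g G' ≤ riskMeasure g (lawOf (hDown g F μ σ l)) →
        G' = lawOf (hDown g F μ σ l)) := by
    intro G' hG'
    have hM : HasMoments G' μ σ := hG'.1
    rw [mem_uncertaintySet_iff hσF hσ hF hM] at hG'
    have hn := hM.norm_centre_quantile hσ.le
    have hne : centre hM.memLp_quantile ≠ 0 := by
      rw [← norm_ne_zero_iff, hn]; exact hσ.ne'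
    have hcond : l * (cosine (centre hF.memLp_quantile) (m l)
          * (‖centre hF.memLp_quantile‖ * σ))
        ≤ l * ⟪centre hF.memLp_quantile, centre hM.memLp_quantile⟫ := by
      by_cases h0 : l = 0
      · simp [h0]
      · have h1 := (ofReal_sqDist_le_iff hσF hσ (cosine_le_one _ _)).1 (hG'.trans (hεl h0))
        rw [← cosine_mul P.q_ne hne, hn]
        gcongr
    obtain ⟨h1, h2⟩ := P.inner_le_of_norm_eq hl hM.centre_mem hn hcond
    rw [hrisk, hM.riskMeasure_eq hg hgac hγ]
    refine ⟨by linarith, fun h => hM.eq_of_centre_eq hG ?_⟩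
    rw [hc]
    exact h2 (by linarith)
  refine ⟨hq, ?_, ?_, ?_⟩
  · ext G'
    constructor
    · rintro ⟨h1, h2⟩
      exact (hopt G' h1).2 (h2 _ hmem)
    · rintro rfl
      exact ⟨hmem, fun G' hG' => (hopt G' hG').1⟩
  · rw [hrisk, std_mul_corr_weight_kDown hstd P]; ring
  · refine le_antisymm (iInf₂_le _ hmem) (le_iInf₂ fun G' hG' => ?_)
    exact_mod_cast (hopt G' hG').1

end Path

/-! ### Step functions -/

/-- The step function with a jump of height `1` at `a`. -/
noncomputable def step (a : ℝ) : ℝ → ℝ := (Ioi a).indicator fun _ => 1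

theorem memLp_step (a : ℝ) : MemLp (step a) 2 unif := (memLp_const 1).indicator measurableSet_Ioi

theorem monotone_step (a : ℝ) : Monotone (step a) := fun x y hxy => by
  by_cases hx : x ∈ Ioi a
  · have hy : y ∈ Ioi a := lt_of_lt_of_le hx hxy
    simp [step, hx, hy]
  · rw [step, indicator_of_notMem hx]
    exact indicator_nonneg (fun _ _ => zero_le_one) _

theorem integral_mul_step (X : ℝ → ℝ) (a : ℝ) :
    ∫ u, X u * step a u ∂unif = ∫ u in Ioi a, X u ∂unif := by
  rw [step, integral_mul_indicator, integral_indicator measurableSet_Ioi]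

theorem mean_step {a : ℝ} (h0 : 0 ≤ a) (h1 : a ≤ 1) : mean (step a) = 1 - a := by
  have h := integral_mul_step (fun _ => 1) a
  simp only [one_mul] at h
  rw [mean, h, setIntegral_const, smul_eq_mul, mul_one, ← compl_Iic,
    probReal_compl_eq_one_sub measurableSet_Iic, real_unif_Iic h0 h1]

theorem inner_centre_step {X : ℝ → ℝ} (hX : MemLp X 2 unif) {a : ℝ} (h0 : 0 ≤ a) (h1 : a ≤ 1) :
    ⟪centre hX, centre (memLp_step a)⟫ = (∫ u in Ioi a, X u ∂unif) - mean X * (1 - a) := by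
  rw [inner_centre_eq_sub, integral_mul_step, mean_step h0 h1]

theorem centre_step_mem (a : ℝ) : centre (memLp_step a) ∈ monoCone :=
  centre_mem_monoCone _ ((monotone_step a).monotoneOn _)

/-- Centred non-decreasing functions that do not vanish have positive upper tail integrals. -/
theorem tail_pos_of_monotoneOn {w : ℝ → ℝ} (hw : Integrable w unif)
    (hmono : MonotoneOn w (Ioo 0 1)) (h0 : ∫ u, w u ∂unif = 0) (hne : ¬ w =ᵐ[unif] 0) {a : ℝ}
    (ha : a ∈ Ioo (0 : ℝ) 1) : 0 < ∫ u in Ioi a, w u ∂unif := by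
  refine lt_of_le_of_ne (tail_nonneg_of_monotoneOn hw hmono h0 ha) fun heq => hne ?_
  have hIic : ∫ u in Iic a, w u ∂unif = 0 := by
    have := setIntegral_compl_Iic hw a
    linarith
  have upper : (∀ u ∈ Ioo (0 : ℝ) 1, a < u → 0 ≤ w u) → ∀ᵐ u ∂unif, a < u → w u = 0 := by
    intro h
    have h1 := (setIntegral_eq_zero_iff_of_nonneg_ae (μ := unif) (s := Ioi a) (f := w) (by
      filter_upwards [ae_restrict_of_ae ae_mem_Ioo, ae_restrict_mem measurableSet_Ioi]
        with u hu hau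
      exact h u hu hau) hw.integrableOn).1 heq.symm
    exact (ae_restrict_iff' measurableSet_Ioi).1 h1
  have lower : (∀ u ∈ Ioo (0 : ℝ) 1, u ≤ a → w u ≤ 0) → ∀ᵐ u ∂unif, u ≤ a → w u = 0 := by
    intro h
    have h1 := (setIntegral_eq_zero_iff_of_nonneg_ae (μ := unif) (s := Iic a)
      (f := fun u => -w u) (by
      filter_upwards [ae_restrict_of_ae ae_mem_Ioo, ae_restrict_mem measurableSet_Iic]
        with u hu hau
      exact neg_nonneg.2 (h u hu hau)) hw.neg.integrableOn).1 (by
        rw [integral_neg, hIic, neg_zero])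
    filter_upwards [(ae_restrict_iff' measurableSet_Iic).1 h1] with u hu hua
    exact neg_eq_zero.1 (hu hua)
  -- The sign of `w a` gives `w` a sign on one side of `a`, where it must then vanish a.e. A point
  -- `b` on that side with `w b = 0` fixes the sign of `w` on the other side.
  have key : (∀ᵐ u ∂unif, a < u → w u = 0) ∧ ∀ᵐ u ∂unif, u ≤ a → w u = 0 := by
    rcases le_total 0 (w a) with h | h
    · have hu := upper fun u hu hau => h.trans (hmono ha hu hau.le)
      refine ⟨hu, lower fun u hu' hua => ?_⟩
      obtain ⟨b, hb, hbz⟩ := exists_mem_Ioo_of_ae hu ha.1.le ha.2 le_rfl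
      rw [← hbz hb.1]
      exact hmono hu' ⟨ha.1.trans hb.1, hb.2⟩ (hua.trans hb.1.le)
    · have hl := lower fun u hu hua => (hmono hu ha hua).trans h
      refine ⟨upper fun u hu' hua => ?_, hl⟩
      obtain ⟨b, hb, hbz⟩ := exists_mem_Ioo_of_ae hl le_rfl ha.1 ha.2.le
      rw [← hbz hb.2.le]
      exact hmono ⟨hb.1, hb.2.trans ha.2⟩ hu' (hb.2.trans hua).le
  filter_upwards [key.1, key.2] with u h1 h2
  rcases lt_or_ge a u with h | h
  · exact h1 h
  · exact h2 h

/-! ### The case of a constant projection at `l = 0` -/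

section Main

variable {g : ℝ → ℝ} {F : Measure ℝ} {μF σF μ σ : ℝ}

/-- Steps are the test functions that recover `g - id` from the centred weight. -/
theorem inner_weight_step (hg : IsDistortion g) (hgac : AbsolutelyContinuousOnInterval g 0 1)
    (hγ : MemLp (weight g) 2 unif) {x : ℝ} (hx : x ∈ Icc (0 : ℝ) 1) :
    ⟪centre hγ, centre (memLp_step (1 - x))⟫ = g x - x := by
  have h1 : mean (weight g) = 1 := integral_weight hg hgac
  rw [inner_centre_step hγ (sub_nonneg.2 hx.2) (by linarith [hx.1]), h1,
    integral_weight_Ioi hg hgac ⟨sub_nonneg.2 hx.2, by linarith [hx.1]⟩, sub_sub_cancel, one_mul]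

theorem std_weight_ne_zero (hg : IsDistortion g) (hgac : AbsolutelyContinuousOnInterval g 0 1)
    (hγ : MemLp (weight g) 2 unif) (hγ1 : ¬ weight g =ᵐ[unif] fun _ => (1 : ℝ)) :
    std (weight g) ≠ 0 := by
  rw [← norm_centre hγ, norm_ne_zero_iff]
  intro h
  have h1 : mean (weight g) = 1 := integral_weight hg hgac
  have h2 := centre_ae hγ
  rw [h] at h2
  refine hγ1 ?_
  filter_upwards [h2, Lp.coeFn_zero ℝ 2 unif] with u h3 h4
  rw [h4, h1] at h3
  simp only [Pi.zero_apply] at h3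
  linarith

theorem isDistortion_id : IsDistortion fun x => x := ⟨fun _ _ _ _ h => h, rfl, rfl⟩

theorem absolutelyContinuous_id : AbsolutelyContinuousOnInterval (fun x : ℝ => x) 0 1 :=
  LipschitzOnWith.absolutelyContinuousOnInterval (K := 1) LipschitzWith.id.lipschitzOnWith

theorem weight_id : weight (fun x => x) = fun _ => 1 := by
  ext u
  exact derivWithin_id' _ _ (uniqueDiffWithinAt_Iio _)

/-- If `g > id` on `(0,1)`, then the risk measure strictly exceeds the mean. -/
theorem lt_riskMeasure (hg : IsDistortion g) (hgac : AbsolutelyContinuousOnInterval g 0 1)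
    (hγ : MemLp (weight g) 2 unif) (hgt : ∀ x ∈ Ioo (0 : ℝ) 1, x < g x) (hσ : 0 < σ)
    {G : Measure ℝ} (hG : HasMoments G μ σ) : μ < riskMeasure g G := by
  have hγid : MemLp (weight fun x => x) 2 unif := by rw [weight_id]; exact memLp_const 1
  obtain ⟨i1, i2, -⟩ := riskMeasure_eq hg hgac hγ G hG.memLp_quantile
  obtain ⟨j1, j2, j3⟩ := riskMeasure_eq isDistortion_id absolutelyContinuous_id hγid G
    hG.memLp_quantile
  have hμ : riskMeasure (fun x => x) G = μ := by
    rw [j3, weight_id, ← hG.mean_quantile]; simp [mean]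
  -- The mean is the risk measure of the identity distortion, so the excess over the mean is the
  -- integral of `g - id` at the survival function.
  set ψ : ℝ → ℝ := fun x => g (1 - cdf G x) - (1 - cdf G x) with hψ
  have hψ0 : ∀ x, 0 ≤ ψ x := by
    intro x
    have h0 := cdf_nonneg G x
    have h1 := cdf_le_one G x
    simp only [hψ]
    rcases eq_or_lt_of_le h0 with h | h
    · rw [← h, sub_zero, hg.map_one, sub_self]
    · rcases eq_or_lt_of_le h1 with h' | h'
      · rw [h', sub_self, hg.map_zero, sub_self]
      · exact (sub_pos.2 (hgt _ ⟨by linarith, by linarith⟩)).le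
  have k1 : IntegrableOn ψ (Ioi 0) := i1.sub j1
  have k2 : IntegrableOn ψ (Iio 0) := by
    refine (j2.sub i2).congr (Eventually.of_forall fun x => ?_)
    simp only [hψ, Pi.sub_apply]; ring
  have hsum : riskMeasure g G - μ = (∫ x in Iio 0, ψ x) + ∫ x in Ioi 0, ψ x := by
    rw [← hμ, riskMeasure, riskMeasure]
    have e1 : ∫ x in Ioi (0 : ℝ), ψ x
        = (∫ x in Ioi 0, g (1 - cdf G x)) - ∫ x in Ioi 0, (1 - cdf G x) := integral_sub i1 j1
    have e2 : ∫ x in Iio (0 : ℝ), ψ x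
        = (∫ x in Iio 0, (1 - (1 - cdf G x))) - ∫ x in Iio 0, (1 - g (1 - cdf G x)) := by
      rw [← integral_sub j2 i2]
      congr 1; ext x; simp only [hψ]; ring
    rw [e1, e2]; ring
  have n1 : 0 ≤ ∫ x in Ioi (0 : ℝ), ψ x := integral_nonneg hψ0
  have n2 : 0 ≤ ∫ x in Iio (0 : ℝ), ψ x := integral_nonneg hψ0
  by_contra hle
  have z1 : ∫ x in Ioi (0 : ℝ), ψ x = 0 := by linarith [not_lt.1 hle]
  have z2 : ∫ x in Iio (0 : ℝ), ψ x = 0 := by linarith [not_lt.1 hle]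
  have a1 := (setIntegral_eq_zero_iff_of_nonneg_ae (Eventually.of_forall hψ0) k1).1 z1
  have a2 := (setIntegral_eq_zero_iff_of_nonneg_ae (Eventually.of_forall hψ0) k2).1 z2
  rw [EventuallyEq, ae_restrict_iff' measurableSet_Ioi] at a1
  rw [EventuallyEq, ae_restrict_iff' measurableSet_Iio] at a2
  have hne0 : ∀ᵐ x ∂(volume : Measure ℝ), x ≠ 0 :=
    measure_eq_zero_iff_ae_notMem.1 (measure_singleton (0 : ℝ))
  have hψae : ∀ᵐ x ∂(volume : Measure ℝ), ψ x = 0 := by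
    filter_upwards [a1, a2, hne0] with x h1 h2 h3
    rcases lt_or_gt_of_ne h3 with h | h
    · exact h2 h
    · exact h1 h
  -- Two distinct quantiles would enclose an interval on which the distribution function lies
  -- strictly between `0` and `1`, where `ψ > 0`.
  have hconst : ∀ a ∈ Ioo (0 : ℝ) 1, ∀ b ∈ Ioo (0 : ℝ) 1, a ≤ b → quantile G a = quantile G b := by
    intro a ha b hb hab
    refine le_antisymm (monotoneOn_quantile G ha hb hab) ?_
    by_contra hlt
    have hne : NeBot (ae (volume.restrict (Ioo (quantile G a) (quantile G b)))) := by
      rw [ae_neBot, Ne, Measure.restrict_eq_zero, Real.volume_Ioo]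
      simpa using hlt
    have hae : ∀ᵐ x ∂(volume.restrict (Ioo (quantile G a) (quantile G b))),
        x ∈ Ioo (quantile G a) (quantile G b) ∧ ψ x = 0 :=
      (ae_restrict_mem measurableSet_Ioo).and (ae_restrict_of_ae hψae)
    obtain ⟨x, hx, hxz⟩ := hae.exists
    have h1 := (quantile_le_iff G ha x).1 hx.1.le
    have h2 := (lt_quantile_iff G hb x).1 hx.2
    have := hgt (1 - cdf G x) ⟨by linarith [hb.2], by linarith [ha.1]⟩
    simp only [hψ] at hxz
    linarith
  have hhalf : (1 / 2 : ℝ) ∈ Ioo (0 : ℝ) 1 := by norm_num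
  have hc0 : centre hG.memLp_quantile = 0 := by
    refine centre_eq_of_ae _ (c := quantile G (1 / 2)) (inner_zero_right _) ?_
    filter_upwards [ae_mem_Ioo, Lp.coeFn_zero ℝ 2 unif] with u hu h0
    rw [h0]
    simp only [Pi.zero_apply, zero_add]
    rcases le_total u (1 / 2) with h | h
    · exact hconst u hu _ hhalf h
    · exact (hconst _ hhalf u hu h).symm
  have := hG.norm_centre_quantile hσ.le
  rw [hc0, norm_zero] at this
  exact hσ.ne this

/-- At a fixed point of `g` the step at `1 - x` is orthogonal to the centred weight but not to `q`,
so a limit direction exists; its law has risk `μ`, the lower bound, and its cosine is exactly the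
threshold. -/
theorem exists_mem_bestCaseSet_of_fixedPoint (hg : IsDistortion g)
    (hgac : AbsolutelyContinuousOnInterval g 0 1) {hγ : MemLp (weight g) 2 unif} (hσF : 0 < σF)
    (hσ : 0 < σ) (hF : HasMoments F μF σF) {m : ℝ → Lp ℝ 2 unif}
    (P : ConePath monoCone oneL2 (centre hF.memLp_quantile) (centre hγ) m)
    (hpos : ∀ l, 0 < l → m l ≠ 0) (h0 : m 0 = 0) {x : ℝ} (hx : x ∈ Ioo (0 : ℝ) 1) (hgx : g x = x)
    {ε : ℝ≥0∞} (hε : ENNReal.ofReal (sqDist μF σF μ σ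
      (ConePath.startCosine (centre hF.memLp_quantile) m)) ≤ ε) :
    (bestCaseSet g F μ σ ε).Nonempty := by
  have hx' : 1 - x ∈ Ioo (0 : ℝ) 1 := ⟨by linarith [hx.2], by linarith [hx.1]⟩
  have hgw : ⟪centre hγ, centre (memLp_step (1 - x))⟫ = 0 := by
    rw [inner_weight_step hg hgac hγ ⟨hx.1.le, hx.2.le⟩, hgx, sub_self]
  have hqw : 0 < ⟪centre hF.memLp_quantile, centre (memLp_step (1 - x))⟫ := by
    have hQ := memLp_sub_mean hF.memLp_quantile
    have h1 := tail_pos_of_monotoneOn (MemLp.integrable_unif hQ)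
      (fun a ha b hb hab => sub_le_sub_right (monotoneOn_quantile F ha hb hab) _)
      (mean_sub_mean hF.memLp_quantile) (fun h => P.q_ne ?_) hx'
    · have h2 : mean (fun u => quantile F u - mean (quantile F)) = 0 :=
        mean_sub_mean hF.memLp_quantile
      have h3 := inner_centre_step hQ hx'.1.le hx'.2.le
      rw [h2, zero_mul, sub_zero] at h3
      rw [← h3] at h1
      convert h1 using 2
      exact (centre_eq_of_ae hQ (c := 0) (inner_oneL2_centre _) (by
        filter_upwards [centre_ae hF.memLp_quantile] with u hu
        rw [hu, add_zero])).symm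
    · refine Lp.ext ?_
      filter_upwards [centre_ae hF.memLp_quantile, h, Lp.coeFn_zero ℝ 2 unif] with u a b c
      rw [a, c]; exact b
  obtain ⟨v, hvC, hv0, hgv, hcos⟩ :=
    P.exists_limit_direction isClosed_monoCone hpos h0 (centre_step_mem (1 - x)) hgw hqw
  obtain ⟨G, hG, hGv⟩ := exists_law_of_direction μ hσ hvC hv0
  have hrisk : riskMeasure g G = μ := by
    rw [hG.riskMeasure_eq hg hgac hγ, hGv, inner_smul_right, hgv]; simp
  refine ⟨G, ?_, fun G' hG' => ?_⟩
  · rw [mem_uncertaintySet_iff hσF hσ hF hG, hGv,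
      cosine_smul_right _ _ (div_pos hσ (norm_pos_iff.2 hv0)), hcos]
    exact hε
  · have hM : HasMoments G' μ σ := hG'.1
    rw [hrisk, hM.riskMeasure_eq hg hgac hγ]
    linarith [P.inner_g_nonneg h0 hM.centre_mem]

/-- `m 0 = 0` makes `μ` a lower bound; the laws with positive parameter are all feasible for this
radius, and their risks tend to `μ`. -/
theorem bestCaseValue_eq_mean (hg : IsDistortion g)
    (hgac : AbsolutelyContinuousOnInterval g 0 1) {hγ : MemLp (weight g) 2 unif} (hσF : 0 < σF)
    (hσ : 0 < σ) (hF : HasMoments F μF σF) {m : ℝ → Lp ℝ 2 unif}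
    (P : ConePath monoCone oneL2 (centre hF.memLp_quantile) (centre hγ) m)
    (hpos : ∀ l, 0 < l → m l ≠ 0) (h0 : m 0 = 0) {ε : ℝ≥0∞}
    (hε : ENNReal.ofReal (sqDist μF σF μ σ
      (ConePath.startCosine (centre hF.memLp_quantile) m)) ≤ ε) :
    bestCaseValue g F μ σ ε = (μ : EReal) ∧
      ∀ G ∈ bestCaseSet g F μ σ ε, riskMeasure g G = μ := by
  have hlow : ∀ G ∈ uncertaintySet F μ σ ε, μ ≤ riskMeasure g G := by
    intro G hG'
    have hM : HasMoments G μ σ := hG'.1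
    rw [hM.riskMeasure_eq hg hgac hγ]
    linarith [P.inner_g_nonneg h0 hM.centre_mem]
  have hmem : ∀ l, 0 < l → lawOf (hDown g F μ σ l) ∈ uncertaintySet F μ σ ε := fun l hl =>
    hDown_mem_uncertaintySet hF hσF hσ P (hpos l hl) ((ENNReal.ofReal_le_ofReal
      ((sqDist_le_iff hσF hσ).2 (P.startCosine_le hl))).trans hε)
  have hlim : Tendsto (fun l => riskMeasure g (lawOf (hDown g F μ σ l))) (𝓝[>] 0) (𝓝 μ) := by
    have h1 := ((P.tendsto_inner_unit hpos h0).const_mul σ).add_const μ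
    rw [mul_zero, zero_add] at h1
    refine h1.congr' ?_
    filter_upwards [self_mem_nhdsWithin] with l hl
    rw [riskMeasure_hDown hg hgac hσ P (hpos l hl), ← inner_smul_right, smul_smul, mul_one_div]
  refine ⟨le_antisymm ?_ (le_iInf₂ fun G hG => by exact_mod_cast hlow G hG), fun G hG => ?_⟩
  · refine ge_of_tendsto ((continuous_coe_real_ereal.tendsto μ).comp hlim) ?_
    filter_upwards [self_mem_nhdsWithin] with l hl
    exact iInf₂_le _ (hmem l hl)
  · refine le_antisymm (ge_of_tendsto hlim ?_) (hlow G hG.1)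
    filter_upwards [self_mem_nhdsWithin] with l hl
    exact hG.2 _ (hmem l hl)

theorem bestCaseSet_eq_empty_iff (hg : IsDistortion g)
    (hgac : AbsolutelyContinuousOnInterval g 0 1) {hγ : MemLp (weight g) 2 unif} (hσF : 0 < σF)
    (hσ : 0 < σ) (hF : HasMoments F μF σF) {m : ℝ → Lp ℝ 2 unif}
    (P : ConePath monoCone oneL2 (centre hF.memLp_quantile) (centre hγ) m)
    (hpos : ∀ l, 0 < l → m l ≠ 0) (h0 : m 0 = 0) {ε : ℝ≥0∞}
    (hε : ENNReal.ofReal (sqDist μF σF μ σ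
      (ConePath.startCosine (centre hF.memLp_quantile) m)) ≤ ε) :
    bestCaseSet g F μ σ ε = ∅ ↔ ∀ x ∈ Ioo (0 : ℝ) 1, g x ≠ x := by
  constructor
  · intro h x hx hgx
    obtain ⟨G, hG⟩ :=
      exists_mem_bestCaseSet_of_fixedPoint hg hgac hσF hσ hF P hpos h0 hx hgx hε
    rw [h] at hG
    exact hG
  · intro h
    refine eq_empty_of_forall_notMem fun G hG => ?_
    -- Nonnegativity on steps gives `g ≥ id`; the absence of fixed points makes it strict.
    have hgt : ∀ x ∈ Ioo (0 : ℝ) 1, x < g x := fun x hx => by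
      have h1 := P.inner_g_nonneg h0 (centre_step_mem (1 - x))
      rw [inner_weight_step hg hgac hγ ⟨hx.1.le, hx.2.le⟩] at h1
      exact lt_of_le_of_ne (by linarith) (h x hx).symm
    have h1 := (bestCaseValue_eq_mean hg hgac hσF hσ hF P hpos h0 hε).2 G hG
    have hM : HasMoments G μ σ := hG.1.1
    exact (lt_riskMeasure hg hgac hγ hgt hσ hM).ne' h1

end Main

end DistortionBounds

/-! ### Translation between radii and cosines, and conclusion -/

theorem theorem3
    -- the distortion function and its square-integrable weight function
    (g : ℝ → ℝ) (hg : DistortionBounds.IsDistortion g)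
    (hgac : AbsolutelyContinuousOnInterval g 0 1)
    (hγ : MemLp (DistortionBounds.weight g) 2 DistortionBounds.unif)
    (hγ1 : ¬ DistortionBounds.weight g =ᵐ[DistortionBounds.unif] fun _ => (1 : ℝ))
    -- the reference distribution
    (F : Measure ℝ) (μF σF : ℝ) (hσF : 0 < σF) (hF : DistortionBounds.HasMoments F μF σF)
    -- the prescribed mean and standard deviation
    (μ σ : ℝ) (hσ : 0 < σ)
    (hlam : DistortionBounds.lamDown g F = 0) :
    -- the antitonic projections are well defined
    (∀ l : ℝ, 0 ≤ l →
      DistortionBounds.IsAntitonicProj (DistortionBounds.target g F l)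
        (DistortionBounds.kDown g F l) ∧
      ∀ k : ℝ → ℝ, DistortionBounds.IsAntitonicProj (DistortionBounds.target g F l) k →
        EqOn k (DistortionBounds.kDown g F l) (Ioo 0 1)) ∧
    ∃ c₀ : ℝ,
      Tendsto (fun l : ℝ => DistortionBounds.corr (DistortionBounds.quantile F)
        (fun u => -DistortionBounds.kDown g F l u)) (𝓝[>] 0) (𝓝 c₀) ∧
      -- Case 1
      (∀ ε : ℝ≥0∞, ENNReal.ofReal ((μF - μ) ^ 2 + (σF - σ) ^ 2) < ε →
        ε < ENNReal.ofReal ((μF - μ) ^ 2 + (σF - σ) ^ 2 + 2 * σ * σF * (1 - c₀)) →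
        ∃ l : ℝ, 0 < l ∧
          DistortionBounds.wasserstein F
            (DistortionBounds.lawOf (DistortionBounds.hDown g F μ σ l)) = ε ^ (1 / 2 : ℝ) ∧
          (∀ l' : ℝ, 0 < l' → DistortionBounds.wasserstein F
            (DistortionBounds.lawOf (DistortionBounds.hDown g F μ σ l')) = ε ^ (1 / 2 : ℝ) →
              l' = l) ∧
          DistortionBounds.SolvedBy g F μ σ ε l) ∧
      ContinuousOn (fun ε : ℝ≥0∞ => DistortionBounds.bestCaseValue g F μ σ ε)
        (Ioo (ENNReal.ofReal ((μF - μ) ^ 2 + (σF - σ) ^ 2))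
          (ENNReal.ofReal ((μF - μ) ^ 2 + (σF - σ) ^ 2 + 2 * σ * σF * (1 - c₀)))) ∧
      -- Case 2
      (∀ ε : ℝ≥0∞, ENNReal.ofReal ((μF - μ) ^ 2 + (σF - σ) ^ 2) < ε →
        ENNReal.ofReal ((μF - μ) ^ 2 + (σF - σ) ^ 2 + 2 * σ * σF * (1 - c₀)) ≤ ε →
        (¬ DistortionBounds.IsConst (DistortionBounds.kDown g F 0) →
          DistortionBounds.SolvedBy g F μ σ ε 0) ∧
        (DistortionBounds.IsConst (DistortionBounds.kDown g F 0) →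
          DistortionBounds.bestCaseValue g F μ σ ε = (μ : EReal) ∧
          (DistortionBounds.bestCaseSet g F μ σ ε = ∅ ↔
            ∀ x ∈ Ioo (0 : ℝ) 1, g x ≠ x))) := by
  obtain ⟨m, P⟩ := DistortionBounds.exists_conePath hγ hσF hF
  have hpos : ∀ l, 0 < l → m l ≠ 0 := fun l hl =>
    DistortionBounds.ne_zero_of_lamDown_eq_zero P hlam hl
  have hQ := hF.memLp_quantile
  have hstd := DistortionBounds.std_weight_ne_zero hg hgac hγ hγ1
  have hpl := DistortionBounds.hasPlateauProperty_monoCone P.q_mem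
  set q := DistortionBounds.centre hF.memLp_quantile with hq
  set c₀ := DistortionBounds.ConePath.startCosine q m
  have hdpos : 0 < 2 * σ * σF := by positivity
  have hbase : 0 ≤ (μF - μ) ^ 2 + (σF - σ) ^ 2 := by positivity
  -- the correlation belonging to a given radius
  set K : ℝ≥0∞ → ℝ := fun ε => 1 - (ε.toReal - ((μF - μ) ^ 2 + (σF - σ) ^ 2)) / (2 * σ * σF)
    with hK
  have hdist : ∀ ε : ℝ≥0∞, ε ≠ ⊤ →
      ENNReal.ofReal (DistortionBounds.sqDist μF σF μ σ (K ε)) = ε := by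
    intro ε hε
    rw [DistortionBounds.sqDist, hK]
    simp only
    rw [sub_sub_cancel, mul_div_cancel₀ _ hdpos.ne', add_sub_cancel, ENNReal.ofReal_toReal hε]
  have hKmem : ∀ ε : ℝ≥0∞, ENNReal.ofReal ((μF - μ) ^ 2 + (σF - σ) ^ 2) < ε →
      ε < ENNReal.ofReal ((μF - μ) ^ 2 + (σF - σ) ^ 2 + 2 * σ * σF * (1 - c₀)) →
      ε ≠ ⊤ ∧ K ε ∈ Ioo c₀ 1 := by
    intro ε h1 h2
    have hne : ε ≠ ⊤ := (h2.trans ENNReal.ofReal_lt_top).ne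
    rw [ENNReal.ofReal_lt_iff_lt_toReal hbase hne] at h1
    rw [ENNReal.lt_ofReal_iff_toReal_lt hne] at h2
    refine ⟨hne, ?_, ?_⟩
    · have : (ε.toReal - ((μF - μ) ^ 2 + (σF - σ) ^ 2)) / (2 * σ * σF) < 1 - c₀ := by
        rw [div_lt_iff₀ hdpos]; linarith
      simp only [hK]; linarith
    · have : 0 < (ε.toReal - ((μF - μ) ^ 2 + (σF - σ) ^ 2)) / (2 * σ * σF) :=
        div_pos (by linarith) hdpos
      simp only [hK]; linarith
  have hex : ∀ k ∈ Ioo c₀ 1, ∃ l, 0 < l ∧ DistortionBounds.cosine q (m l) = k ∧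
      ∀ l', 0 < l' → DistortionBounds.cosine q (m l') = k → l' = l := fun k hk =>
    P.exists_unique_cosine_eq hpl hpos hk.1 hk.2
  have hsolved : ∀ ε : ℝ≥0∞, ε ≠ ⊤ → ∀ l, 0 < l → DistortionBounds.cosine q (m l) = K ε →
      DistortionBounds.SolvedBy g F μ σ ε l := fun ε hε l hl hlK =>
    DistortionBounds.solvedBy_of_cosine hg hgac hstd hF hσF hσ P hl.le (hpos l hl)
      (by rw [← hq, hlK, hdist ε hε]) (fun _ => by rw [← hq, hlK, hdist ε hε])
  refine ⟨fun l _ => ⟨DistortionBounds.isAntitonicProj_kDown hγ hQ l, fun k hk =>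
    hk.eqOn (DistortionBounds.memLp_target hγ hQ l)
      (DistortionBounds.isAntitonicProj_kDown hγ hQ l)⟩, c₀, ?_, ?_, ?_, ?_⟩
  · simp_rw [DistortionBounds.corr_quantile_neg_kDown P]
    exact P.tendsto_startCosine hpos
  · intro ε h1 h2
    obtain ⟨hne, hmem⟩ := hKmem ε h1 h2
    obtain ⟨l, hl, hlK, huniq⟩ := hex _ hmem
    refine ⟨l, hl, ?_, fun l' hl' hW => huniq l' hl' ?_, hsolved ε hne l hl hlK⟩
    · rw [DistortionBounds.wasserstein_hDown hF hσF hσ P (hpos l hl), ← hq, hlK, hdist ε hne]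
    · rw [DistortionBounds.wasserstein_hDown hF hσF hσ P (hpos l' hl'), ← hq] at hW
      have h3 := ENNReal.rpow_left_injective (by norm_num : (1 / 2 : ℝ) ≠ 0) hW
      have h4 := h3.trans (hdist ε hne).symm
      -- `ENNReal.ofReal` is injective only on nonnegative reals, so the cosines are compared by two
      -- inequalities, each using that a cosine is at most `1`.
      exact le_antisymm
        ((DistortionBounds.ofReal_sqDist_le_iff hσF hσ (DistortionBounds.cosine_le_one _ _)).1 h4.ge)
        ((DistortionBounds.ofReal_sqDist_le_iff hσF hσ hmem.2.le).1 h4.le)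
  -- The value is `μ + σ` times the value function of the cosine, which is continuous, composed with
  -- the affine map from radius to cosine.
  · choose! lam hlam0 hlamK _ using hex
    have hval := P.continuousOn_value hpos (lam := lam) fun k hk => ⟨hlam0 k hk, hlamK k hk⟩
    have hKc : ContinuousOn K (Ioo (ENNReal.ofReal ((μF - μ) ^ 2 + (σF - σ) ^ 2))
        (ENNReal.ofReal ((μF - μ) ^ 2 + (σF - σ) ^ 2 + 2 * σ * σF * (1 - c₀)))) :=
      continuousOn_const.sub (((ENNReal.continuousOn_toReal.mono fun ε hε =>
        (hKmem ε hε.1 hε.2).1).sub continuousOn_const).div_const _)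
    have hcomp := ((hval.comp hKc fun ε hε => (hKmem ε hε.1 hε.2).2).const_mul σ).add
      (continuousOn_const (c := μ))
    refine (continuous_coe_real_ereal.comp_continuousOn hcomp).congr fun ε hε => ?_
    obtain ⟨hne, hmem⟩ := hKmem ε hε.1 hε.2
    have hl := hlam0 _ hmem
    have hs := hsolved ε hne _ hl (hlamK _ hmem)
    simp only [Function.comp_apply, Pi.add_apply]
    rw [hs.optimal, DistortionBounds.riskMeasure_hDown hg hgac hσ P (hpos _ hl),
      ← real_inner_smul_right, smul_smul, mul_one_div]
  · intro ε h1 h2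
    refine ⟨fun hconst => ?_, fun hconst => ?_⟩
    · rw [DistortionBounds.isConst_kDown_iff P] at hconst
      refine DistortionBounds.solvedBy_of_cosine hg hgac hstd hF hσF hσ P le_rfl hconst ?_
        (fun h => absurd rfl h)
      -- When the path does not vanish at `0`, continuity identifies the cosine there with the limit
      -- `c₀`.
      rw [P.cosine_zero_eq hpos hconst]
      exact h2
    · rw [DistortionBounds.isConst_kDown_iff P] at hconst
      exact ⟨(DistortionBounds.bestCaseValue_eq_mean hg hgac hσF hσ hF P hpos hconst h2).1,
        DistortionBounds.bestCaseSet_eq_empty_iff hg hgac hσF hσ hF P hpos hconst h2⟩
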